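/- Let $X$ be a proper metric space and let $\mathscr{H}$ be an ample $X$-module: a complex Hilbert space with a non-degenerate $*$-representation of $C_0(X)$ in which only $f=0$ acts as a compact operator. For a Borel set $W\subseteq X$ let $\chi_W$ denote also the projection on $\mathscr{H}$ by which the indicator function of $W$ acts under the extension of the representation to bounded Borel functions. The Roe algebra $C^*_{\mathrm{Roe}}(X)\subseteq B(\mathscr{H})$ is the norm closure of the $*$-algebra of all operators $T$ that are locally compact ($\chi_WT$ and $T\chi_W$ are compact for all bounded Borel sets $W$) and of finite propagation (there is $r\ge 0$ with $\chi_VT\chi_W=0$ for all Borel sets $V,W$ with $d(V,W)>r$). For $Y\subseteq X$ put $B_r(Y)=\{x : d(x,y)\le r \text{ for some } y\in Y\}$, let $\{Y\}$ be the family of all sets contained in some $B_r(Y)$, $r>0$, and let the coarse boundary be $\partial Y=\{A\cap B : A\in\{Y\},\ B\in\{X\setminus Y\}\}$. Let $C^*_{\mathrm{Roe}}(\partial Y)$ be the closure of the set of all $T\in C^*_{\mathrm{Roe}}(X)$ for which there is $Z\in\partial Y$ such that $fT=Tf=0$ for all $f\in C_0(X)$ with support in $X\setminus Z$, and let $C^*_{\mathrm{Roe}}(\partial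 Y)^+$ be its unitalization. Let $Y,W\subseteq X$ be Borel sets that are transversal: $Z\cap Z'$ is bounded for all $Z\in\partial Y$, $Z'\in\partial W$. For a unitary $u\in C^*_{\mathrm{Roe}}(\partial Y)^+\otimes M_n(\mathbb{C})$, acting on $\mathscr{H}^n$, and with $\chi_W$ acting diagonally on $\mathscr{H}^n$, put $$F_u=\chi_Wu\chi_W+\chi_{X\setminus W}.$$ Then $F_u$ is a Fredholm operator on $\mathscr{H}^n$ whose index depends only on the class $[u]\in K_1(C^*_{\mathrm{Roe}}(\partial Y))$ (the stable homotopy class of $u$ among unitaries in matrix algebras over the unitalization), so that $\theta_W([u])=\operatorname{ind}(F_u)$ defines a map $\theta_W:K_1(C^*_{\mathrm{Roe}}(\partial Y))\to\mathbb{Z}$. If $u[\chi_W,u^*]$ is trace class, then $$\theta_W([u])=\operatorname{Tr}\bigl(u[\chi_W,u^*]\bigr).$$ -/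

import Mathlib

open scoped InnerProductSpace ZeroAtInfty

universe u v

noncomputable section

namespace RoeKubo

/-! ### Trace-class operators and Fredholm operators on a Hilbert space -/

section Operators

variable {E : Type u} [NormedAddCommGroup E] [InnerProductSpace ℂ E] [CompleteSpace E]

/-- `T` is trace class: `∑ ⟨e_i, |T| e_i⟩ < ∞` for an orthonormal basis `(e_i)`, where
`|T| = (T* T)^{1/2}`. The terms are nonnegative, and the choice of the basis does not matter. -/
def IsTraceClass (T : E →L[ℂ] E) : Prop :=
  ∃ (ι : Type u) (b : HilbertBasis ι ℂ E), Summable fun i => ⟪b i, CFC.abs T (b i)⟫_ℂ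

/-- `Tr T = z`: the sum `∑ ⟨e_i, T e_i⟩` converges (unconditionally) to `z` for every orthonormal
basis `(e_i)`. -/
def HasTrace (T : E →L[ℂ] E) (z : ℂ) : Prop :=
  ∀ (ι : Type u) (b : HilbertBasis ι ℂ E), HasSum (fun i => ⟪b i, T (b i)⟫_ℂ) z

/-- Finite-dimensional kernel and cokernel (the range is then automatically closed). -/
def IsFredholm (F : E →L[ℂ] E) : Prop :=
  FiniteDimensional ℂ (LinearMap.ker (F : E →ₗ[ℂ] E)) ∧
    FiniteDimensional ℂ (E ⧸ LinearMap.range (F : E →ₗ[ℂ] E))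

/-- `dim ker F - dim coker F`. -/
def fredholmIndex (F : E →L[ℂ] E) : ℤ :=
  (Module.finrank ℂ (LinearMap.ker (F : E →ₗ[ℂ] E)) : ℤ) -
    Module.finrank ℂ (E ⧸ LinearMap.range (F : E →ₗ[ℂ] E))

/-- The operator on `E^n = E ⊕ ⋯ ⊕ E` given by an `n × n` matrix of operators on `E`. -/
def blockOp {n : ℕ} (M : Matrix (Fin n) (Fin n) (E →L[ℂ] E)) :
    PiLp 2 (fun _ : Fin n => E) →L[ℂ] PiLp 2 (fun _ : Fin n => E) :=
  ((PiLp.continuousLinearEquiv 2 ℂ (fun _ : Fin n => E)).symm :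
      (Fin n → E) →L[ℂ] PiLp 2 (fun _ : Fin n => E)) ∘L
    ContinuousLinearMap.pi fun i => ∑ j, M i j ∘L PiLp.proj 2 (fun _ : Fin n => E) j

end Operators

/-! ### Modules over a metric space

An `X`-module is a Hilbert space `H` with an action `ρ` of the C⋆-algebra `C₀(X)`. -/

section XModule

variable {X : Type v} [MetricSpace X]
variable {H : Type u} [NormedAddCommGroup H] [InnerProductSpace ℂ H] [CompleteSpace H]

/-- The closed subspace of `H` spanned by all `f ξ` with `f ∈ C₀(X)` vanishing outside `U` and
`ξ ∈ H`. -/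
def essentialSubspace (ρ : C₀(X, ℂ) →⋆ₙₐ[ℂ] (H →L[ℂ] H)) (U : Set X) : Submodule ℂ H :=
  (Submodule.span ℂ {η | ∃ f : C₀(X, ℂ), (∀ x ∉ U, f x = 0) ∧ ∃ ξ : H, η = ρ f ξ}).topologicalClosure

/-- The action is non-degenerate: `C₀(X) H` is total in `H`. -/
def IsNondegenerate (ρ : C₀(X, ℂ) →⋆ₙₐ[ℂ] (H →L[ℂ] H)) : Prop :=
  essentialSubspace ρ Set.univ = ⊤

/-- Only `f = 0` acts as a compact operator. -/
def IsAmple (ρ : C₀(X, ℂ) →⋆ₙₐ[ℂ] (H →L[ℂ] H)) : Prop :=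
  ∀ f : C₀(X, ℂ), IsCompactOperator (ρ f) → f = 0

/-- The range of `χ_W`. -/
def spectralSubspace (ρ : C₀(X, ℂ) →⋆ₙₐ[ℂ] (H →L[ℂ] H)) (W : Set X) : Submodule ℂ H :=
  ⨅ U : {U : Set X // IsOpen U ∧ W ⊆ U}, essentialSubspace ρ U.1

theorem isClosed_spectralSubspace (ρ : C₀(X, ℂ) →⋆ₙₐ[ℂ] (H →L[ℂ] H)) (W : Set X) :
    IsClosed (spectralSubspace ρ W : Set H) := by
  rw [spectralSubspace, Submodule.coe_iInf]
  exact isClosed_iInter fun U => Submodule.isClosed_topologicalClosure _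

instance (ρ : C₀(X, ℂ) →⋆ₙₐ[ℂ] (H →L[ℂ] H)) (W : Set X) :
    (spectralSubspace ρ W).HasOrthogonalProjection :=
  haveI : CompleteSpace (spectralSubspace ρ W) :=
    (isClosed_spectralSubspace ρ W).completeSpace_coe
  inferInstance

/-- The operator by which the indicator function `χ_W` of a Borel set `W` acts on `H`, under the
extension of the action from `C₀(X)` to bounded Borel functions (the value at `W` of the spectral
measure of `ρ`). For `U` open, `χ_U` is the supremum of the operators `f` with `0 ≤ f ≤ 1` in
`C₀(X)` vanishing outside `U`, that is, the projection onto the closure of `C₀(U) H`; for `W` Borel,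
`χ_W` is the infimum of the projections `χ_U` over the open sets `U ⊇ W`, since finite Borel
measures on a metric space are outer regular. -/
def chi (ρ : C₀(X, ℂ) →⋆ₙₐ[ℂ] (H →L[ℂ] H)) (W : Set X) : H →L[ℂ] H :=
  (spectralSubspace ρ W).starProjection

/-- `χ_W T` and `T χ_W` are compact for all bounded Borel sets `W`. -/
def IsLocallyCompact [MeasurableSpace X] (ρ : C₀(X, ℂ) →⋆ₙₐ[ℂ] (H →L[ℂ] H))
    (T : H →L[ℂ] H) : Prop :=
  ∀ W : Set X, MeasurableSet W → Bornology.IsBounded W →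
    IsCompactOperator (chi ρ W * T) ∧ IsCompactOperator (T * chi ρ W)

/-- For some `r ≥ 0`, `χ_V T χ_W = 0` for all Borel sets `V`, `W` with `d(V, W) > r`. -/
def HasFinitePropagation [MeasurableSpace X] (ρ : C₀(X, ℂ) →⋆ₙₐ[ℂ] (H →L[ℂ] H))
    (T : H →L[ℂ] H) : Prop :=
  ∃ r : ℝ, 0 ≤ r ∧ ∀ V W : Set X, MeasurableSet V → MeasurableSet W →
    ENNReal.ofReal r < (⨅ x ∈ V, ⨅ y ∈ W, edist x y) → chi ρ V * T * chi ρ W = 0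

/-- The Roe algebra of `X`: the norm closure of the algebra of locally compact operators of finite
propagation (these already form a ⋆-algebra, so that `adjoin` adds nothing). -/
def roeAlgebra [MeasurableSpace X] (ρ : C₀(X, ℂ) →⋆ₙₐ[ℂ] (H →L[ℂ] H)) :
    NonUnitalStarSubalgebra ℂ (H →L[ℂ] H) :=
  (NonUnitalStarAlgebra.adjoin ℂ
    {T : H →L[ℂ] H | IsLocallyCompact ρ T ∧ HasFinitePropagation ρ T}).topologicalClosure

/-- `T` is supported in the family `𝒴`: there is `Z ∈ 𝒴` with `f T = T f = 0` for all `f` with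
support in `X ∖ Z`. -/
def IsSupportedIn (ρ : C₀(X, ℂ) →⋆ₙₐ[ℂ] (H →L[ℂ] H)) (𝒴 : Set (Set X)) (T : H →L[ℂ] H) : Prop :=
  ∃ Z ∈ 𝒴, ∀ f : C₀(X, ℂ), tsupport f ⊆ Zᶜ → ρ f * T = 0 ∧ T * ρ f = 0

/-- The Roe algebra localized at a big family `𝒴`: the closure of the operators in the Roe algebra
that are supported in `𝒴` (for a big family they form a ⋆-algebra, so that `adjoin` adds
nothing). -/
def localizedRoeAlgebra [MeasurableSpace X] (ρ : C₀(X, ℂ) →⋆ₙₐ[ℂ] (H →L[ℂ] H))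
    (𝒴 : Set (Set X)) : NonUnitalStarSubalgebra ℂ (H →L[ℂ] H) :=
  (NonUnitalStarAlgebra.adjoin ℂ
    {T : H →L[ℂ] H | T ∈ roeAlgebra ρ ∧ IsSupportedIn ρ 𝒴 T}).topologicalClosure

end XModule

/-! ### Big families -/

section Coarse

variable {X : Type v} [MetricSpace X]

/-- `B_r(Y)`. -/
def neighborhood (r : ℝ) (Y : Set X) : Set X := {x | ∃ y ∈ Y, dist x y ≤ r}

/-- The big family `{Y}` of all sets contained in a uniform thickening of `Y`. -/
def thickenings (Y : Set X) : Set (Set X) := {Z | ∃ r : ℝ, 0 < r ∧ Z ⊆ neighborhood r Y}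

/-- The intersection of two big families: all intersections of members. -/
def interFamily (𝒴 𝒵 : Set (Set X)) : Set (Set X) := Set.image2 (fun A B => A ∩ B) 𝒴 𝒵

/-- The coarse boundary `∂Y = {Y} ∩ {X ∖ Y}`. -/
def coarseBoundary (Y : Set X) : Set (Set X) := interFamily (thickenings Y) (thickenings Yᶜ)

/-- `Y` and `W` are transversal: every member of `∂Y ∩ ∂W` is bounded. -/
def AreTransversal (Y W : Set X) : Prop :=
  ∀ Z ∈ interFamily (coarseBoundary Y) (coarseBoundary W), Bornology.IsBounded Z

end Coarse

/-! ### The `K₁`-group, as a set of classes of unitaries, and the index map -/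

section KTheory

variable {H : Type u} [NormedAddCommGroup H] [InnerProductSpace ℂ H] [CompleteSpace H]

/-- The unitary group of `A⁺ ⊗ M_n(ℂ)`, with `A⁺` the unitalization of `A`. -/
abbrev UnitaryOver (A : NonUnitalStarSubalgebra ℂ (H →L[ℂ] H)) (n : ℕ) : Type u :=
  unitary (Matrix (Fin n) (Fin n) (Unitization ℂ A))

/-- The block sum `u ⊕ 1_{N-n}` of an `n × n` matrix `u`, for `n ≤ N`. -/
def stabilize {R : Type u} [Zero R] [One R] {n : ℕ} (N : ℕ) (u : Matrix (Fin n) (Fin n) R) :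
    Matrix (Fin N) (Fin N) R :=
  Matrix.of fun i j =>
    if h : i.1 < n ∧ j.1 < n then u ⟨i.1, h.1⟩ ⟨j.1, h.2⟩ else if i = j then 1 else 0

/-- `u` and `v` are stably homotopic: for some `N`, `u ⊕ 1` and `v ⊕ 1` are joined by a norm
continuous path of unitaries in `A⁺ ⊗ M_N(ℂ)`. -/
def StablyHomotopic (A : NonUnitalStarSubalgebra ℂ (H →L[ℂ] H))
    (u v : Σ n : ℕ, UnitaryOver A n) : Prop :=
  ∃ N : ℕ, u.1 ≤ N ∧ v.1 ≤ N ∧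
    ∃ γ : C(unitInterval, Matrix (Fin N) (Fin N) (Unitization ℂ A)),
      (∀ t, γ t ∈ unitary (Matrix (Fin N) (Fin N) (Unitization ℂ A))) ∧
        γ 0 = stabilize N u.2.1 ∧ γ 1 = stabilize N v.2.1

/-- `K₁(A)`: stable homotopy classes of unitaries in the matrix algebras over `A⁺`. -/
def K1 (A : NonUnitalStarSubalgebra ℂ (H →L[ℂ] H)) : Type u := Quot (StablyHomotopic A)

/-- The class `[u]` in `K₁(A)`. -/
def K1.mk {A : NonUnitalStarSubalgebra ℂ (H →L[ℂ] H)} {n : ℕ} (u : UnitaryOver A n) : K1 A :=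
  Quot.mk _ ⟨n, u⟩

/-- The operator on `H^n` given by a unitary `u ∈ A⁺ ⊗ M_n(ℂ)`, where `A⁺` acts on `H` through
`λ + a ↦ λ 1 + a`. -/
def unitaryOp {A : NonUnitalStarSubalgebra ℂ (H →L[ℂ] H)} {n : ℕ} (u : UnitaryOver A n) :
    PiLp 2 (fun _ : Fin n => H) →L[ℂ] PiLp 2 (fun _ : Fin n => H) :=
  blockOp (u.1.map (NonUnitalStarSubalgebra.unitization A))

variable {X : Type v} [MetricSpace X]

/-- `χ_W` acting diagonally on `H^n`. -/
def chiN (ρ : C₀(X, ℂ) →⋆ₙₐ[ℂ] (H →L[ℂ] H)) (n : ℕ) (W : Set X) :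
    PiLp 2 (fun _ : Fin n => H) →L[ℂ] PiLp 2 (fun _ : Fin n => H) :=
  blockOp (Matrix.diagonal fun _ => chi ρ W)

/-- `F_u = χ_W u χ_W + χ_{X ∖ W}`. -/
def toeplitzOp (ρ : C₀(X, ℂ) →⋆ₙₐ[ℂ] (H →L[ℂ] H)) (W : Set X)
    {A : NonUnitalStarSubalgebra ℂ (H →L[ℂ] H)} {n : ℕ} (u : UnitaryOver A n) :
    PiLp 2 (fun _ : Fin n => H) →L[ℂ] PiLp 2 (fun _ : Fin n => H) :=
  chiN ρ n W * unitaryOp u * chiN ρ n W + chiN ρ n Wᶜ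

/-- The map `θ_W : K₁(A) → ℤ`, `[u] ↦ ind F_u`: the index of `F_u` for a representative `u` of the
class. The index does not depend on the representative. -/
def theta (ρ : C₀(X, ℂ) →⋆ₙₐ[ℂ] (H →L[ℂ] H)) (W : Set X)
    (A : NonUnitalStarSubalgebra ℂ (H →L[ℂ] H)) (c : K1 A) : ℤ :=
  fredholmIndex (toeplitzOp ρ W (Quot.out c).2)

end KTheory

end RoeKubo

end

noncomputable section

namespace RoeKubo

/-! ### The index of a linear endomorphism -/

section LinearIndex

variable {K : Type*} [Field K] {V V' : Type*} [AddCommGroup V] [Module K V]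
  [AddCommGroup V'] [Module K V']

theorem finiteDimensional_and_finrank_of_ker_range (f : V →ₗ[K] V')
    [FiniteDimensional K (LinearMap.ker f)] [FiniteDimensional K (LinearMap.range f)] :
    FiniteDimensional K V ∧
      Module.finrank K V =
        Module.finrank K (LinearMap.ker f) + Module.finrank K (LinearMap.range f) := by
  have h1 : FiniteDimensional K (V ⧸ LinearMap.ker f) :=
    LinearEquiv.finiteDimensional f.quotKerEquivRange.symm
  have h2 : FiniteDimensional K V := Module.Finite.of_submodule_quotient (LinearMap.ker f)
  exact ⟨h2, by rw [add_comm]; exact (f.finrank_range_add_finrank_ker).symm⟩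

theorem index_comp (f g : V →ₗ[K] V)
    [FiniteDimensional K (LinearMap.ker f)] [FiniteDimensional K (V ⧸ LinearMap.range f)]
    [FiniteDimensional K (LinearMap.ker g)] [FiniteDimensional K (V ⧸ LinearMap.range g)] :
    FiniteDimensional K (LinearMap.ker (f ∘ₗ g)) ∧
    FiniteDimensional K (V ⧸ LinearMap.range (f ∘ₗ g)) ∧
    (Module.finrank K (LinearMap.ker (f ∘ₗ g)) : ℤ)
        - Module.finrank K (V ⧸ LinearMap.range (f ∘ₗ g)) =
      ((Module.finrank K (LinearMap.ker f) : ℤ) - Module.finrank K (V ⧸ LinearMap.range f)) +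
      ((Module.finrank K (LinearMap.ker g) : ℤ) - Module.finrank K (V ⧸ LinearMap.range g)) := by
  have hle : LinearMap.ker g ≤ LinearMap.ker (f ∘ₗ g) := fun x hx => by
    simp only [LinearMap.mem_ker, LinearMap.comp_apply] at hx ⊢; rw [hx, map_zero]
  have hle' : LinearMap.range (f ∘ₗ g) ≤ LinearMap.range f := LinearMap.range_comp_le_range g f
  -- the kernel of the composition
  let f1 := g.domRestrict (LinearMap.ker (f ∘ₗ g))
  have k1 : LinearMap.ker f1 = (LinearMap.ker g).comap (LinearMap.ker (f ∘ₗ g)).subtype := rfl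
  have r1 : LinearMap.range f1 = LinearMap.range g ⊓ LinearMap.ker f := by
    rw [LinearMap.range_domRestrict, LinearMap.ker_comp, Submodule.map_comap_eq]
  let e1 : LinearMap.ker f1 ≃ₗ[K] LinearMap.ker g :=
    (LinearEquiv.ofEq _ _ k1).trans (Submodule.comapSubtypeEquivOfLe hle)
  have : FiniteDimensional K (LinearMap.ker f1) := LinearEquiv.finiteDimensional e1.symm
  have : FiniteDimensional K (LinearMap.range f1) := by
    rw [r1]; exact Submodule.finiteDimensional_of_le inf_le_right
  obtain ⟨d1, n1⟩ := finiteDimensional_and_finrank_of_ker_range f1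
  rw [e1.finrank_eq, r1] at n1
  -- the kernel of the left factor
  let f2 := (LinearMap.range g).mkQ ∘ₗ (LinearMap.ker f).subtype
  have k2 : LinearMap.ker f2 =
      (LinearMap.range g ⊓ LinearMap.ker f).comap (LinearMap.ker f).subtype := by
    rw [LinearMap.ker_comp, Submodule.ker_mkQ]
    ext x; simp
  have r2 : LinearMap.range f2 = (LinearMap.ker f).map (LinearMap.range g).mkQ := by
    rw [LinearMap.range_comp, Submodule.range_subtype]
  let e2 : LinearMap.ker f2 ≃ₗ[K] (LinearMap.range g ⊓ LinearMap.ker f : Submodule K V) :=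
    (LinearEquiv.ofEq _ _ k2).trans (Submodule.comapSubtypeEquivOfLe inf_le_right)
  obtain ⟨-, n2⟩ := finiteDimensional_and_finrank_of_ker_range f2
  rw [e2.finrank_eq, r2] at n2
  -- the cokernel of the right factor
  let f3 := (LinearMap.range g).mapQ (LinearMap.range (f ∘ₗ g)) f
    (by rintro _ ⟨x, rfl⟩; exact ⟨x, rfl⟩)
  have k3 : LinearMap.ker f3 = (LinearMap.ker f).map (LinearMap.range g).mkQ := by
    ext x
    obtain ⟨x, rfl⟩ := Submodule.mkQ_surjective _ x
    constructor
    · intro hx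
      have hx' : f x ∈ LinearMap.range (f ∘ₗ g) := by
        simpa [f3, LinearMap.mem_ker, Submodule.mapQ_apply] using hx
      obtain ⟨y, hy⟩ := hx'
      refine ⟨x - g y, ?_, ?_⟩
      · simp only [SetLike.mem_coe, LinearMap.mem_ker, map_sub]
        rw [← hy]; simp
      · rw [map_sub, sub_eq_self]
        simp
    · rintro ⟨y, hy, hyx⟩
      rw [← hyx]
      have : f y = 0 := hy
      simp [f3, LinearMap.mem_ker, Submodule.mapQ_apply, this]
  have r3 : LinearMap.range f3 =
      (LinearMap.range f).map (LinearMap.range (f ∘ₗ g)).mkQ := by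
    simp only [f3]
    rw [Submodule.range_mapQ]
  obtain ⟨-, n3⟩ := finiteDimensional_and_finrank_of_ker_range f3
  rw [k3, r3] at n3
  have : FiniteDimensional K
      ((LinearMap.range f).map (LinearMap.range (f ∘ₗ g)).mkQ) := by
    rw [← r3]; infer_instance
  -- the cokernel of the composition
  let f4 := Submodule.factor hle'
  have k4 : LinearMap.ker f4 =
      (LinearMap.range f).map (LinearMap.range (f ∘ₗ g)).mkQ := by
    simp only [f4]
    exact Submodule.ker_mapQ _ _ _ _
  have r4 : LinearMap.range f4 = ⊤ := LinearMap.range_eq_top.2 (Submodule.factor_surjective hle')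
  have : FiniteDimensional K (LinearMap.ker f4) := by rw [k4]; infer_instance
  obtain ⟨d4, n4⟩ := finiteDimensional_and_finrank_of_ker_range f4
  rw [k4, r4, finrank_top] at n4
  refine ⟨d1, d4, ?_⟩
  omega

/-- If `f` restricts to `g` on a subspace `ι V'`, and induces an isomorphism of the quotient by this
subspace, then `f` and `g` have isomorphic kernels and cokernels. -/
theorem nonempty_ker_coker_equiv (i : V' →ₗ[K] V) (f : V →ₗ[K] V) (g : V' →ₗ[K] V')
    (hi : Function.Injective i) (hfg : ∀ x, f (i x) = i (g x))
    (hinj : ∀ x, f x ∈ LinearMap.range i → x ∈ LinearMap.range i)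
    (hsurj : ∀ x, ∃ y z, x = i y + f z) :
    Nonempty (LinearMap.ker g ≃ₗ[K] LinearMap.ker f) ∧
      Nonempty ((V' ⧸ LinearMap.range g) ≃ₗ[K] (V ⧸ LinearMap.range f)) := by
  constructor
  · refine ⟨LinearEquiv.ofBijective
      ((i ∘ₗ (LinearMap.ker g).subtype).codRestrict (LinearMap.ker f) fun x => ?_) ⟨?_, ?_⟩⟩
    · have : g x = 0 := x.2
      simp [LinearMap.mem_ker, hfg, this]
    · intro x y hxy
      exact Subtype.ext (hi (congrArg Subtype.val hxy))
    · rintro ⟨x, hx⟩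
      rw [LinearMap.mem_ker] at hx
      obtain ⟨y, rfl⟩ := hinj x (by rw [hx]; exact Submodule.zero_mem _)
      refine ⟨⟨y, ?_⟩, rfl⟩
      rw [hfg] at hx
      exact hi (by rw [hx, map_zero])
  · refine ⟨LinearEquiv.ofBijective
      ((LinearMap.range g).mapQ (LinearMap.range f) i ?_) ⟨?_, ?_⟩⟩
    · rintro _ ⟨x, rfl⟩
      exact ⟨i x, hfg x⟩
    · rw [← LinearMap.ker_eq_bot, LinearMap.ker_eq_bot']
      intro x hx
      obtain ⟨x, rfl⟩ := Submodule.mkQ_surjective _ x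
      simp only [Submodule.mkQ_apply, Submodule.mapQ_apply, Submodule.Quotient.mk_eq_zero] at hx ⊢
      obtain ⟨z, hz⟩ := hx
      obtain ⟨w, rfl⟩ := hinj z (by rw [hz]; exact ⟨x, rfl⟩)
      rw [hfg] at hz
      exact ⟨w, hi hz⟩
    · intro x
      obtain ⟨x, rfl⟩ := Submodule.mkQ_surjective _ x
      obtain ⟨y, z, rfl⟩ := hsurj x
      refine ⟨Submodule.Quotient.mk y, ?_⟩
      simp

theorem index_one_add_of_finiteDimensional_range (r : V →ₗ[K] V)
    [FiniteDimensional K (LinearMap.range r)] :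
    FiniteDimensional K (LinearMap.ker (1 + r)) ∧
    FiniteDimensional K (V ⧸ LinearMap.range (1 + r)) ∧
    (Module.finrank K (LinearMap.ker (1 + r)) : ℤ)
        - Module.finrank K (V ⧸ LinearMap.range (1 + r)) = 0 := by
  let g : LinearMap.range r →ₗ[K] LinearMap.range r :=
    (1 + r).restrict (p := LinearMap.range r) (q := LinearMap.range r) fun x hx =>
      Submodule.add_mem _ hx ⟨x, rfl⟩
  obtain ⟨⟨e1⟩, ⟨e2⟩⟩ := nonempty_ker_coker_equiv (LinearMap.range r).subtype (1 + r) g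
    Subtype.val_injective (fun x => rfl)
    (fun x hx => by
      rw [Submodule.range_subtype] at hx ⊢
      have h : (1 + r) x - r x = x := by simp
      rw [← h]
      exact Submodule.sub_mem _ hx ⟨x, rfl⟩)
    (fun x => ⟨⟨-r x, Submodule.neg_mem _ ⟨x, rfl⟩⟩, x, by simp⟩)
  refine ⟨LinearEquiv.finiteDimensional e1, LinearEquiv.finiteDimensional e2, ?_⟩
  rw [← e1.finrank_eq, ← e2.finrank_eq]
  have h1 := g.finrank_range_add_finrank_ker
  have h2 := Submodule.finrank_quotient_add_finrank (LinearMap.range g)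
  omega

end LinearIndex

/-! ### Compact operators and the Fredholm index on a Hilbert space -/

section Fredholm

variable {E : Type u} [NormedAddCommGroup E] [InnerProductSpace ℂ E]

theorem IsFredholm.mul {S T : E →L[ℂ] E} (hS : IsFredholm S) (hT : IsFredholm T) :
    IsFredholm (S * T) := by
  obtain ⟨_, _⟩ := hS
  obtain ⟨_, _⟩ := hT
  exact ⟨(index_comp (S : E →ₗ[ℂ] E) T).1, (index_comp (S : E →ₗ[ℂ] E) T).2.1⟩

theorem fredholmIndex_mul {S T : E →L[ℂ] E} (hS : IsFredholm S) (hT : IsFredholm T) :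
    fredholmIndex (S * T) = fredholmIndex S + fredholmIndex T := by
  obtain ⟨_, _⟩ := hS
  obtain ⟨_, _⟩ := hT
  exact (index_comp (S : E →ₗ[ℂ] E) T).2.2

theorem ker_eq_bot_and_range_eq_top_of_isUnit {T : E →L[ℂ] E} (hT : IsUnit T) :
    LinearMap.ker (T : E →ₗ[ℂ] E) = ⊥ ∧ LinearMap.range (T : E →ₗ[ℂ] E) = ⊤ := by
  obtain ⟨w, rfl⟩ := hT
  refine ⟨LinearMap.ker_eq_bot'.2 fun x hx => ?_, LinearMap.range_eq_top.2 fun x => ⟨w.inv x, ?_⟩⟩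
  · have h : w.inv (w.val x) = x := congrArg (fun f : E →L[ℂ] E => f x) w.inv_val
    have hx' : w.val x = 0 := hx
    rw [← h, hx', map_zero]
  · exact congrArg (fun f : E →L[ℂ] E => f x) w.val_inv

theorem isFredholm_of_isUnit {T : E →L[ℂ] E} (hT : IsUnit T) : IsFredholm T := by
  obtain ⟨h1, h2⟩ := ker_eq_bot_and_range_eq_top_of_isUnit hT
  unfold IsFredholm
  rw [h1, h2]
  exact ⟨inferInstance, inferInstance⟩

theorem fredholmIndex_of_isUnit {T : E →L[ℂ] E} (hT : IsUnit T) : fredholmIndex T = 0 := by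
  obtain ⟨h1, h2⟩ := ker_eq_bot_and_range_eq_top_of_isUnit hT
  unfold fredholmIndex
  rw [h1, h2, finrank_bot, Module.finrank_zero_of_subsingleton, sub_self]

/-- A compact operator is approximated in norm by its compressions to finite-dimensional ranges. -/
theorem exists_finiteDimensional_norm_sub_lt {K : E →L[ℂ] E} (hK : IsCompactOperator K)
    {ε : ℝ} (hε : 0 < ε) :
    ∃ V : Submodule ℂ E, ∃ _ : FiniteDimensional ℂ V, ‖K - V.starProjection * K‖ < ε := by
  have hc := hK.isCompact_closure_image_closedBall (f := (K : E →ₗ[ℂ] E)) 1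
  obtain ⟨t, htf, ht⟩ := Metric.totallyBounded_iff.1 (hc.totallyBounded.subset subset_closure)
    (ε / 2) (half_pos hε)
  have hfd : FiniteDimensional ℂ (Submodule.span ℂ t) := FiniteDimensional.span_of_finite ℂ htf
  refine ⟨Submodule.span ℂ t, hfd, lt_of_le_of_lt ?_ (half_lt_self hε)⟩
  refine ContinuousLinearMap.opNorm_le_of_unit_norm (half_pos hε).le fun x hx => ?_
  have hmem : K x ∈ (⇑(K : E →ₗ[ℂ] E)) '' Metric.closedBall 0 1 :=
    ⟨x, by simp [hx], rfl⟩
  obtain ⟨y, hy, hxy⟩ := Set.mem_iUnion₂.1 (ht hmem)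
  have h1 : ‖K x - (Submodule.span ℂ t).starProjection (K x)‖ ≤ ‖K x - y‖ := by
    rw [Submodule.starProjection_minimal]
    exact ciInf_le ⟨0, Set.forall_mem_range.mpr fun _ => norm_nonneg _⟩
      (⟨y, Submodule.subset_span hy⟩ : Submodule.span ℂ t)
  calc ‖(K - (Submodule.span ℂ t).starProjection * K) x‖
      = ‖K x - (Submodule.span ℂ t).starProjection (K x)‖ := rfl
    _ ≤ ‖K x - y‖ := h1
    _ ≤ ε / 2 := by rw [← dist_eq_norm]; exact (Metric.mem_ball.1 hxy).le

theorem isCompactOperator_starProjection (V : Submodule ℂ E) [FiniteDimensional ℂ V] :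
    IsCompactOperator V.starProjection := by
  have h : IsCompactOperator (V.orthogonalProjectionOnto : E → V) :=
    ⟨Metric.closedBall 0 1, isCompact_closedBall _ _,
      V.orthogonalProjectionOnto.continuous.continuousAt.preimage_mem_nhds
        (by simpa using Metric.closedBall_mem_nhds (0 : V) one_pos)⟩
  exact h.clm_comp V.subtypeL

variable [CompleteSpace E]

theorem isCompactOperator_star {K : E →L[ℂ] E} (hK : IsCompactOperator K) :
    IsCompactOperator (star K : E →L[ℂ] E) := by
  have hcl : IsClosed {T : E →L[ℂ] E | IsCompactOperator T} := isClosed_setOfPred_isCompactOperator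
  have : star K ∈ closure {T : E →L[ℂ] E | IsCompactOperator T} := by
    refine Metric.mem_closure_iff.2 fun ε hε => ?_
    obtain ⟨V, _, hV⟩ := exists_finiteDimensional_norm_sub_lt hK hε
    refine ⟨star K * V.starProjection, (isCompactOperator_starProjection V).clm_comp (star K), ?_⟩
    have : star K - star K * V.starProjection = star (K - V.starProjection * K) := by
      rw [star_sub, star_mul, (isSelfAdjoint_starProjection V).star_eq]
    rwa [dist_eq_norm, this, norm_star]
  rwa [hcl.closure_eq] at this

theorem isFredholm_and_index_one_add_compact_add {K D : E →L[ℂ] E} (hK : IsCompactOperator K)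
    (hD : ‖D‖ < 1) : IsFredholm (1 + K + D) ∧ fredholmIndex (1 + K + D) = 0 := by
  obtain ⟨V, hV, hKV⟩ := exists_finiteDimensional_norm_sub_lt hK (sub_pos.2 hD)
  have hs : ‖-(D + (K - V.starProjection * K))‖ < 1 := by
    rw [norm_neg]
    exact (norm_add_le _ _).trans_lt (by linarith)
  obtain ⟨w, hw⟩ := isUnit_one_sub_of_norm_lt_one hs
  set R : E →L[ℂ] E := w.inv * (V.starProjection * K) with hR
  have hfac : 1 + K + D = w.val * (1 + R) := by
    have h : w.val * R = V.starProjection * K := by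
      rw [hR, ← mul_assoc, show w.val * w.inv = 1 from w.val_inv, one_mul]
    rw [mul_add, mul_one, h, hw]
    abel
  have hfin : FiniteDimensional ℂ (LinearMap.range (R : E →ₗ[ℂ] E)) := by
    have hle : LinearMap.range (R : E →ₗ[ℂ] E) ≤ V.map (w.inv : E →ₗ[ℂ] E) := by
      rintro _ ⟨x, rfl⟩
      exact ⟨V.starProjection (K x), Submodule.starProjection_apply_mem _ _, rfl⟩
    exact Submodule.finiteDimensional_of_le hle
  have h := index_one_add_of_finiteDimensional_range (R : E →ₗ[ℂ] E)
  have h1 : IsFredholm (1 + R) := ⟨h.1, h.2.1⟩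
  have h2 : fredholmIndex (1 + R) = 0 := h.2.2
  have hu : IsUnit w.val := w.isUnit
  rw [hfac]
  exact ⟨(isFredholm_of_isUnit hu).mul h1, by
    rw [fredholmIndex_mul (isFredholm_of_isUnit hu) h1, h2, fredholmIndex_of_isUnit hu, add_zero]⟩

theorem isFredholm_and_index_of_sub_one_compact {T : E →L[ℂ] E}
    (hT : IsCompactOperator (T - 1 : E →L[ℂ] E)) : IsFredholm T ∧ fredholmIndex T = 0 := by
  have h := isFredholm_and_index_one_add_compact_add (K := T - 1) (D := 0) hT (by simp)
  simpa using h

/-- Atkinson: an operator that is invertible modulo compact operators is Fredholm. -/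
theorem isFredholm_of_parametrix {F S : E →L[ℂ] E}
    (h1 : IsCompactOperator (S * F - 1 : E →L[ℂ] E))
    (h2 : IsCompactOperator (F * S - 1 : E →L[ℂ] E)) : IsFredholm F := by
  obtain ⟨⟨hk, -⟩, -⟩ := isFredholm_and_index_of_sub_one_compact h1
  obtain ⟨⟨-, hc⟩, -⟩ := isFredholm_and_index_of_sub_one_compact h2
  constructor
  · have hle : LinearMap.ker (F : E →ₗ[ℂ] E) ≤ LinearMap.ker ((S * F : E →L[ℂ] E) : E →ₗ[ℂ] E) :=
      LinearMap.ker_le_ker_comp (F : E →ₗ[ℂ] E) (S : E →ₗ[ℂ] E)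
    exact Submodule.finiteDimensional_of_le hle
  · have hle : LinearMap.range ((F * S : E →L[ℂ] E) : E →ₗ[ℂ] E) ≤
        LinearMap.range (F : E →ₗ[ℂ] E) :=
      LinearMap.range_comp_le_range (S : E →ₗ[ℂ] E) (F : E →ₗ[ℂ] E)
    exact Module.Finite.of_surjective _ (Submodule.factor_surjective hle)

theorem fredholmIndex_eq_of_near {F S G : E →L[ℂ] E}
    (h1 : IsCompactOperator (S * F - 1 : E →L[ℂ] E))
    (h2 : IsCompactOperator (F * S - 1 : E →L[ℂ] E)) (hG : IsFredholm G)
    (hGF : ‖S * (G - F)‖ < 1) : fredholmIndex G = fredholmIndex F := by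
  have hF := isFredholm_of_parametrix h1 h2
  have hS := isFredholm_of_parametrix h2 h1
  have e1 := fredholmIndex_mul hS hF
  rw [(isFredholm_and_index_of_sub_one_compact h1).2] at e1
  have e2 := fredholmIndex_mul hS hG
  have e3 := (isFredholm_and_index_one_add_compact_add h1 hGF).2
  rw [show 1 + (S * F - 1) + S * (G - F) = S * G by rw [mul_sub]; abel] at e3
  omega

/-- The index is constant along a norm continuous path of Fredholm operators. -/
theorem fredholmIndex_eq_of_path {F S : unitInterval → E →L[ℂ] E} (hF : Continuous F)
    (h1 : ∀ t, IsCompactOperator (S t * F t - 1 : E →L[ℂ] E))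
    (h2 : ∀ t, IsCompactOperator (F t * S t - 1 : E →L[ℂ] E)) :
    fredholmIndex (F 0) = fredholmIndex (F 1) := by
  have hloc : IsLocallyConstant fun t => fredholmIndex (F t) := by
    refine (IsLocallyConstant.iff_eventually_eq _).2 fun t => ?_
    have hc : Continuous fun s => ‖S t * (F s - F t)‖ := by fun_prop
    have : ∀ᶠ s in nhds t, ‖S t * (F s - F t)‖ < 1 :=
      hc.continuousAt.eventually_lt continuousAt_const (by simp)
    filter_upwards [this] with s hs
    exact fredholmIndex_eq_of_near (h1 t) (h2 t) (isFredholm_of_parametrix (h1 s) (h2 s)) hs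
  exact hloc.apply_eq_of_preconnectedSpace 0 1

/-- If `F*` is a parametrix of `F`, the cokernel of `F` has the dimension of the kernel of `F*`. -/
theorem finrank_coker_eq_finrank_ker_star {F : E →L[ℂ] E}
    (h1 : IsCompactOperator (star F * F - 1 : E →L[ℂ] E))
    (h2 : IsCompactOperator (F * star F - 1 : E →L[ℂ] E)) :
    Module.finrank ℂ (E ⧸ LinearMap.range (F : E →ₗ[ℂ] E)) =
      Module.finrank ℂ (LinearMap.ker (star F : E →L[ℂ] E).toLinearMap) := by
  have key : ∀ G : E →L[ℂ] E, IsFredholm G →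
      Module.finrank ℂ (LinearMap.ker (star G : E →L[ℂ] E).toLinearMap) ≤
        Module.finrank ℂ (E ⧸ LinearMap.range (G : E →ₗ[ℂ] E)) := by
    intro G hG
    have := hG.2
    refine LinearMap.finrank_le_finrank_of_injective
      (f := (LinearMap.range (G : E →ₗ[ℂ] E)).mkQ ∘ₗ
        (LinearMap.ker (star G : E →L[ℂ] E).toLinearMap).subtype) ?_
    rw [← LinearMap.ker_eq_bot, LinearMap.ker_eq_bot']
    rintro ⟨x, hx⟩ h
    have hx0 : star G x = 0 := hx
    simp only [LinearMap.comp_apply, Submodule.subtype_apply, Submodule.mkQ_apply,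
      Submodule.Quotient.mk_eq_zero] at h
    obtain ⟨y, hy⟩ := h
    have hy' : G y = x := hy
    have : ⟪x, x⟫_ℂ = 0 := by
      nth_rw 1 [← hy']
      rw [← ContinuousLinearMap.adjoint_inner_right, ← ContinuousLinearMap.star_eq_adjoint, hx0,
        inner_zero_right]
    exact Subtype.ext (inner_self_eq_zero.1 this)
  have hF := isFredholm_of_parametrix h1 h2
  have hS := isFredholm_of_parametrix h2 h1
  have e1 := fredholmIndex_mul hS hF
  rw [(isFredholm_and_index_of_sub_one_compact h1).2] at e1
  have k1 := key F hF
  have k2 := key (star F) hS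
  rw [star_star] at k2
  unfold fredholmIndex at e1
  omega

end Fredholm

/-! ### Traces of differences of projections -/

section Trace

variable {E : Type u} [NormedAddCommGroup E] [InnerProductSpace ℂ E]

theorem hasSum_norm_inner_sq {ι : Type*} (b : HilbertBasis ι ℂ E) (x : E) :
    HasSum (fun i => ‖⟪b i, x⟫_ℂ‖ ^ 2) (‖x‖ ^ 2) := by
  have h := b.hasSum_inner_mul_inner x x
  rw [← Complex.hasSum_ofReal]
  have h1 : ∀ i, ⟪x, b i⟫_ℂ * ⟪b i, x⟫_ℂ = ((‖⟪b i, x⟫_ℂ‖ ^ 2 : ℝ) : ℂ) := fun i => by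
    rw [← inner_conj_symm x (b i), Complex.conj_mul', Complex.ofReal_pow]
  have h2 : ⟪x, x⟫_ℂ = ((‖x‖ ^ 2 : ℝ) : ℂ) := by
    rw [inner_self_eq_norm_sq_to_K]; simp
  simpa only [h1, h2] using h

/-- The projection to a finite-dimensional subspace has as trace the dimension. -/
theorem hasSum_norm_starProjection_sq {ι : Type*} (b : HilbertBasis ι ℂ E) (N : Submodule ℂ E)
    [FiniteDimensional ℂ N] :
    HasSum (fun i => ‖N.starProjection (b i)‖ ^ 2) (Module.finrank ℂ N : ℝ) := by
  let e := stdOrthonormalBasis ℂ N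
  have h1 : ∀ j, HasSum (fun i => ‖⟪(e j : E), b i⟫_ℂ‖ ^ 2) 1 := fun j => by
    have h := hasSum_norm_inner_sq b (e j : E)
    have h0 : ‖(e j : E)‖ = 1 := e.orthonormal.1 j
    rw [h0, one_pow] at h
    simpa only [norm_inner_symm] using h
  have h2 := hasSum_sum (s := Finset.univ) fun j _ => h1 j
  convert h2 using 1
  · ext i
    rw [Submodule.starProjection_apply, ← Submodule.coe_norm, ← e.sum_sq_norm_inner_right]
    refine Finset.sum_congr rfl fun j _ => ?_
    rw [← Submodule.inner_orthogonalProjectionOnto_eq_of_mem_left]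
  · simp

variable [CompleteSpace E]

/-- The Hilbert–Schmidt norms of `T` and of `T*` agree, in any two orthonormal bases. -/
theorem hasSum_norm_sq_star {ι κ : Type*} (b : HilbertBasis ι ℂ E) (c : HilbertBasis κ ℂ E)
    {T : E →L[ℂ] E} {s : ℝ} (h : HasSum (fun i => ‖T (b i)‖ ^ 2) s) :
    HasSum (fun j => ‖(star T) (c j)‖ ^ 2) s := by
  have key : ∑' j, ENNReal.ofReal (‖(star T) (c j)‖ ^ 2) =
      ∑' i, ENNReal.ofReal (‖T (b i)‖ ^ 2) := by
    have h1 : ∀ j, ENNReal.ofReal (‖(star T) (c j)‖ ^ 2) =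
        ∑' i, ENNReal.ofReal (‖⟪c j, T (b i)⟫_ℂ‖ ^ 2) := fun j => by
      have := hasSum_norm_inner_sq b ((star T) (c j))
      rw [← this.tsum_eq, ENNReal.ofReal_tsum_of_nonneg (fun _ => sq_nonneg _) this.summable]
      refine tsum_congr fun i => ?_
      rw [ContinuousLinearMap.star_eq_adjoint, ContinuousLinearMap.adjoint_inner_right,
        norm_inner_symm]
    have h2 : ∀ i, ENNReal.ofReal (‖T (b i)‖ ^ 2) =
        ∑' j, ENNReal.ofReal (‖⟪c j, T (b i)⟫_ℂ‖ ^ 2) := fun i => by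
      have := hasSum_norm_inner_sq c (T (b i))
      rw [← this.tsum_eq, ENNReal.ofReal_tsum_of_nonneg (fun _ => sq_nonneg _) this.summable]
    simp_rw [h1, h2]
    exact ENNReal.tsum_comm
  have hs : 0 ≤ s := h.nonneg fun _ => sq_nonneg _
  rw [← ENNReal.ofReal_tsum_of_nonneg (fun _ => sq_nonneg _) h.summable, h.tsum_eq] at key
  have hsum : HasSum (fun j => ENNReal.ofReal (‖(star T) (c j)‖ ^ 2)) (ENNReal.ofReal s) := by
    rw [← key]; exact ENNReal.summable.hasSum
  have h3 := ENNReal.hasSum_toReal (f := fun j => ENNReal.ofReal (‖(star T) (c j)‖ ^ 2))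
    (by rw [key]; exact ENNReal.ofReal_ne_top)
  rw [← ENNReal.tsum_toReal_eq (fun _ => ENNReal.ofReal_ne_top), key,
    ENNReal.toReal_ofReal hs] at h3
  simpa [ENNReal.toReal_ofReal] using h3

theorem inner_star_mul_self_apply (T : E →L[ℂ] E) (x : E) :
    ⟪x, (star T * T) x⟫_ℂ = ((‖T x‖ ^ 2 : ℝ) : ℂ) := by
  rw [mul_apply_eq_comp, ContinuousLinearMap.star_eq_adjoint,
    ContinuousLinearMap.adjoint_inner_right, inner_self_eq_norm_sq_to_K]
  simp

/-- A self-adjoint trace class operator is a difference of squares of commuting self-adjoint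
Hilbert–Schmidt operators. -/
theorem IsTraceClass.exists_sq_sub_sq {A : E →L[ℂ] E} (hA : IsSelfAdjoint A)
    (hT : IsTraceClass A) :
    ∃ C D : E →L[ℂ] E, IsSelfAdjoint C ∧ IsSelfAdjoint D ∧ Commute C A ∧ Commute D A ∧
      C * C - D * D = A ∧ ∀ (ι : Type u) (b : HilbertBasis ι ℂ E),
        Summable (fun i => ‖C (b i)‖ ^ 2) ∧ Summable (fun i => ‖D (b i)‖ ^ 2) := by
  have c1 : Continuous fun x : ℝ => √x⁺ := Real.continuous_sqrt.comp continuous_posPart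
  have c2 : Continuous fun x : ℝ => √x⁻ := Real.continuous_sqrt.comp continuous_negPart
  have hC : IsSelfAdjoint (cfc (fun x : ℝ => √x⁺) A) := cfc_predicate _ _
  have hD : IsSelfAdjoint (cfc (fun x : ℝ => √x⁻) A) := cfc_predicate _ _
  have hC2 : cfc (fun x : ℝ => √x⁺) A * cfc (fun x : ℝ => √x⁺) A = cfc (fun x : ℝ => x⁺) A := by
    rw [← cfc_mul _ _ A c1.continuousOn c1.continuousOn]
    exact cfc_congr fun x _ => Real.mul_self_sqrt (posPart_nonneg x)
  have hD2 : cfc (fun x : ℝ => √x⁻) A * cfc (fun x : ℝ => √x⁻) A = cfc (fun x : ℝ => x⁻) A := by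
    rw [← cfc_mul _ _ A c2.continuousOn c2.continuousOn]
    exact cfc_congr fun x _ => Real.mul_self_sqrt (negPart_nonneg x)
  have hsum : cfc (fun x : ℝ => x⁺) A + cfc (fun x : ℝ => x⁻) A = CFC.abs A := by
    rw [CFC.abs_eq_cfc_norm A hA, ← cfc_add A _ _ continuous_posPart.continuousOn
      continuous_negPart.continuousOn]
    exact cfc_congr fun x _ => posPart_add_negPart x
  have hdiff : cfc (fun x : ℝ => x⁺) A - cfc (fun x : ℝ => x⁻) A = A := by
    rw [← cfc_sub _ _ A continuous_posPart.continuousOn continuous_negPart.continuousOn]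
    conv_rhs => rw [← cfc_id ℝ A hA]
    exact cfc_congr fun x _ => posPart_sub_negPart x
  refine ⟨cfc (fun x : ℝ => √x⁺) A, cfc (fun x : ℝ => √x⁻) A, hC, hD,
    (Commute.refl A).cfc (by rw [hA.star_eq]; exact Commute.refl A) _, (Commute.refl A).cfc (by rw [hA.star_eq]; exact Commute.refl A) _,
    by rw [hC2, hD2, hdiff], fun ι b => ?_⟩
  obtain ⟨κ, c, hc⟩ := hT
  have hc' : Summable fun i => ‖cfc (fun x : ℝ => √x⁺) A (c i)‖ ^ 2 +
      ‖cfc (fun x : ℝ => √x⁻) A (c i)‖ ^ 2 := by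
    rw [← Complex.summable_ofReal]
    refine hc.congr fun i => ?_
    rw [← hsum, ← hC2, ← hD2]
    have e1 := inner_star_mul_self_apply (cfc (fun x : ℝ => √x⁺) A) (c i)
    have e2 := inner_star_mul_self_apply (cfc (fun x : ℝ => √x⁻) A) (c i)
    rw [hC.star_eq] at e1
    rw [hD.star_eq] at e2
    rw [add_apply, inner_add_right, e1, e2]
    push_cast; rfl
  have s1 := (hc'.of_nonneg_of_le (fun i => sq_nonneg _) fun i =>
    le_add_of_nonneg_right (sq_nonneg ‖cfc (fun x : ℝ => √x⁻) A (c i)‖)).hasSum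
  have s2 := (hc'.of_nonneg_of_le (fun i => sq_nonneg _) fun i =>
    le_add_of_nonneg_left (sq_nonneg ‖cfc (fun x : ℝ => √x⁺) A (c i)‖)).hasSum
  have t1 := (hasSum_norm_sq_star c b s1).summable
  have t2 := (hasSum_norm_sq_star c b s2).summable
  rw [hC.star_eq] at t1
  rw [hD.star_eq] at t2
  exact ⟨t1, t2⟩

/-- Two self-adjoint operators that anticommute, with squares adding up to the identity. -/
structure IsAnticommutingPair (A B : E →L[ℂ] E) : Prop where
  left_selfAdjoint : IsSelfAdjoint A
  right_selfAdjoint : IsSelfAdjoint B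
  anticommute : B * A = -(A * B)
  sq_add_sq : A * A + B * B = 1

namespace IsAnticommutingPair

variable {A B : E →L[ℂ] E}

theorem norm_sq_add_norm_sq (h : IsAnticommutingPair A B) (x : E) :
    ‖A x‖ ^ 2 + ‖B x‖ ^ 2 = ‖x‖ ^ 2 := by
  have e1 := inner_star_mul_self_apply A x
  have e2 := inner_star_mul_self_apply B x
  have e3 := inner_star_mul_self_apply (1 : E →L[ℂ] E) x
  rw [h.left_selfAdjoint.star_eq] at e1
  rw [h.right_selfAdjoint.star_eq] at e2
  rw [star_one, one_mul] at e3
  nth_rw 1 [← h.sq_add_sq] at e3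
  rw [add_apply, inner_add_right, e1, e2, ← Complex.ofReal_add, Complex.ofReal_inj] at e3
  exact e3

theorem norm_pow_apply_le (h : IsAnticommutingPair A B) (k : ℕ) (x : E) :
    ‖(A ^ k) x‖ ≤ ‖x‖ := by
  induction k with
  | zero => simp
  | succ k ih =>
    rw [pow_succ', mul_apply_eq_comp]
    refine le_trans ?_ ih
    refine (sq_le_sq₀ (norm_nonneg _) (norm_nonneg _)).1 ?_
    rw [← h.norm_sq_add_norm_sq ((A ^ k) x)]
    exact le_add_of_nonneg_right (sq_nonneg _)

theorem commute_sq (h : IsAnticommutingPair A B) : Commute B (A * A) := by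
  have := h.anticommute
  unfold Commute SemiconjBy
  rw [← mul_assoc, this, neg_mul, mul_assoc, this, mul_neg, neg_neg, mul_assoc]

theorem mul_odd_pow (h : IsAnticommutingPair A B) (k : ℕ) :
    B * A ^ (2 * k + 1) = -(A ^ (2 * k + 1) * B) := by
  have hc : Commute B (A ^ (2 * k)) := by
    rw [pow_mul, sq]; exact h.commute_sq.pow_right k
  rw [pow_succ, ← mul_assoc, hc.eq, mul_assoc, h.anticommute, mul_neg, mul_assoc]

theorem tendsto_pow_apply_range (h : IsAnticommutingPair A B) (x : E) :
    Filter.Tendsto (fun k => (A ^ (2 * k + 1)) (B x)) Filter.atTop (nhds 0) := by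
  have hanti : Antitone fun k => ‖(A ^ k) x‖ ^ 2 := antitone_nat_of_succ_le fun k => by
    rw [pow_succ' A k, mul_apply_eq_comp, ← h.norm_sq_add_norm_sq ((A ^ k) x)]
    exact le_add_of_nonneg_right (sq_nonneg _)
  have hlim := tendsto_atTop_ciInf hanti ⟨0, by rintro _ ⟨k, rfl⟩; exact sq_nonneg _⟩
  have hdiff : Filter.Tendsto (fun k => ‖B ((A ^ k) x)‖ ^ 2) Filter.atTop (nhds 0) := by
    have := hlim.sub (hlim.comp (Filter.tendsto_add_atTop_nat 1))
    rw [sub_self] at this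
    refine this.congr fun k => ?_
    simp only [Function.comp_apply]
    rw [pow_succ' A k, mul_apply_eq_comp, ← h.norm_sq_add_norm_sq ((A ^ k) x)]
    ring
  have hodd : Filter.Tendsto (fun k : ℕ => 2 * k + 1) Filter.atTop Filter.atTop :=
    Filter.tendsto_atTop_mono (fun k => by simp only [id]; omega) Filter.tendsto_id
  have hdiff' := hdiff.comp hodd
  have hsqrt : Filter.Tendsto (fun k => ‖(A ^ (2 * k + 1)) (B x)‖ ^ 2) Filter.atTop (nhds 0) := by
    refine hdiff'.congr fun k => ?_
    have e := congrArg (fun T : E →L[ℂ] E => T x) (h.mul_odd_pow k)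
    simp only [mul_apply_eq_comp, neg_apply] at e
    simp only [Function.comp_apply, e, norm_neg]
  rw [tendsto_zero_iff_norm_tendsto_zero]
  have := hsqrt.sqrt
  simpa using this

theorem tendsto_pow_apply_of_orthogonal (h : IsAnticommutingPair A B) {y : E}
    (hy : y ∈ (LinearMap.ker (B : E →ₗ[ℂ] E))ᗮ) :
    Filter.Tendsto (fun k => (A ^ (2 * k + 1)) y) Filter.atTop (nhds 0) := by
  have hcl : y ∈ closure (LinearMap.range (B : E →ₗ[ℂ] E) : Set E) := by
    have h1 := ContinuousLinearMap.orthogonal_range B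
    rw [← ContinuousLinearMap.star_eq_adjoint, h.right_selfAdjoint.star_eq] at h1
    rw [← h1, Submodule.orthogonal_orthogonal_eq_closure] at hy
    exact hy
  rw [Metric.tendsto_atTop]
  intro ε hε
  obtain ⟨_, ⟨x, rfl⟩, hx⟩ := Metric.mem_closure_iff.1 hcl (ε / 2) (half_pos hε)
  obtain ⟨N, hN⟩ := Metric.tendsto_atTop.1 (h.tendsto_pow_apply_range x) (ε / 2) (half_pos hε)
  refine ⟨N, fun k hk => ?_⟩
  have h1 := hN k hk
  rw [dist_zero_right] at h1 ⊢
  have h2 := h.norm_pow_apply_le (2 * k + 1) (y - B x)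
  have h3 : (A ^ (2 * k + 1)) y = (A ^ (2 * k + 1)) (y - B x) + (A ^ (2 * k + 1)) (B x) := by
    rw [← map_add, sub_add_cancel]
  rw [h3]
  refine (norm_add_le _ _).trans_lt ?_
  have h4 : ‖y - B x‖ < ε / 2 := by rw [← dist_eq_norm]; exact hx
  linarith

/-- The odd powers of `A` converge strongly to the difference of the projections to the eigenspaces
for `1` and `-1`. -/
theorem tendsto_pow_apply (h : IsAnticommutingPair A B) {N₁ N₂ : Submodule ℂ E}
    [N₁.HasOrthogonalProjection] [N₂.HasOrthogonalProjection]
    (hN₁ : ∀ x, x ∈ N₁ ↔ A x = x) (hN₂ : ∀ x, x ∈ N₂ ↔ A x = -x) (x : E) :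
    Filter.Tendsto (fun k => (A ^ (2 * k + 1)) x) Filter.atTop
      (nhds (N₁.starProjection x - N₂.starProjection x)) := by
  set x₁ := N₁.starProjection x with hx₁
  set x₂ := N₂.starProjection x with hx₂
  have m1 : A x₁ = x₁ := (hN₁ _).1 (Submodule.starProjection_apply_mem _ _)
  have m2 : A x₂ = -x₂ := (hN₂ _).1 (Submodule.starProjection_apply_mem _ _)
  have hsym : ∀ a b, ⟪A a, b⟫_ℂ = ⟪a, A b⟫_ℂ := fun a b => by
    rw [← ContinuousLinearMap.adjoint_inner_right, ← ContinuousLinearMap.star_eq_adjoint,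
      h.left_selfAdjoint.star_eq]
  have horth : ∀ a b, A a = a → A b = -b → ⟪a, b⟫_ℂ = 0 := fun a b ha hb => by
    have := hsym a b
    rw [ha, hb, inner_neg_right] at this
    exact self_eq_neg.1 this
  have o1 : ∀ z, A z = z → ⟪z, x - x₁ - x₂⟫_ℂ = 0 := fun z hz => by
    rw [inner_sub_right, horth z x₂ hz m2, sub_zero]
    exact Submodule.inner_right_of_mem_orthogonal ((hN₁ z).2 hz)
      (Submodule.sub_starProjection_mem_orthogonal x)
  have o2 : ∀ z, A z = -z → ⟪z, x - x₁ - x₂⟫_ℂ = 0 := fun z hz => by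
    rw [sub_right_comm, inner_sub_right, ← inner_conj_symm z x₁, horth x₁ z m1 hz, map_zero,
      sub_zero]
    exact Submodule.inner_right_of_mem_orthogonal ((hN₂ z).2 hz)
      (Submodule.sub_starProjection_mem_orthogonal x)
  have hy : x - x₁ - x₂ ∈ (LinearMap.ker (B : E →ₗ[ℂ] E))ᗮ := by
    rw [Submodule.mem_orthogonal]
    intro z hz
    have hz' : B z = 0 := hz
    have hzz : A (A z) = z := by
      have := congrArg (fun T : E →L[ℂ] E => T z) h.sq_add_sq
      simpa [mul_apply_eq_comp, hz'] using this
    have p1 := o1 (z + A z) (by rw [map_add, hzz, add_comm])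
    have p2 := o2 (z - A z) (by rw [map_sub, hzz, neg_sub])
    have p3 : (2 : ℂ) * ⟪z, x - x₁ - x₂⟫_ℂ = 0 := by
      have : ⟪(z + A z) + (z - A z), x - x₁ - x₂⟫_ℂ = 0 := by rw [inner_add_left, p1, p2, add_zero]
      rwa [show (z + A z) + (z - A z) = (2 : ℂ) • z by rw [two_smul]; abel, inner_smul_left,
        Complex.conj_ofNat] at this
    exact (mul_eq_zero.1 p3).resolve_left two_ne_zero
  have pow1 : ∀ k : ℕ, (A ^ k) x₁ = x₁ := fun k => by
    induction k with
    | zero => simp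
    | succ k ih => rw [pow_succ, mul_apply_eq_comp, m1, ih]
  have pow2 : ∀ k : ℕ, (A ^ (2 * k + 1)) x₂ = -x₂ := fun k => by
    induction k with
    | zero => simp [m2]
    | succ k ih =>
      rw [show 2 * (k + 1) + 1 = 2 * k + 1 + 1 + 1 by ring, pow_succ, pow_succ, mul_apply_eq_comp,
        mul_apply_eq_comp, m2, map_neg, m2, neg_neg, ih]
  have hlim := (h.tendsto_pow_apply_of_orthogonal hy).const_add (x₁ - x₂)
  rw [add_zero] at hlim
  refine hlim.congr fun k => ?_
  rw [map_sub, map_sub, pow1, pow2]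
  abel

/-- The trace of `A` is the difference of the multiplicities of the eigenvalues `1` and `-1`. -/
theorem hasTrace (h : IsAnticommutingPair A B) (hT : IsTraceClass A) {N₁ N₂ : Submodule ℂ E}
    [FiniteDimensional ℂ N₁] [FiniteDimensional ℂ N₂]
    (hN₁ : ∀ x, x ∈ N₁ ↔ A x = x) (hN₂ : ∀ x, x ∈ N₂ ↔ A x = -x) :
    HasTrace A (((Module.finrank ℂ N₁ : ℤ) - Module.finrank ℂ N₂ : ℤ) : ℂ) := by
  obtain ⟨C, D, hC, hD, hCA, hDA, hCD, hsum⟩ := hT.exists_sq_sub_sq h.left_selfAdjoint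
  intro ι b
  obtain ⟨sC, sD⟩ := hsum ι b
  have hAk : ∀ k : ℕ, star (A ^ k) = A ^ k := fun k => by
    rw [star_pow, h.left_selfAdjoint.star_eq]
  have hBB : B * B = 1 - A * A := eq_sub_of_add_eq' h.sq_add_sq
  have hdouble : ∀ k : ℕ, A ^ k * A ^ k = A ^ (2 * k) := fun k => by rw [← pow_add, two_mul]
  -- the quadratic form of an odd power of `A`
  have hform : ∀ (k : ℕ) (x : E), ⟪x, (A ^ (2 * k + 1)) x⟫_ℂ =
      ((‖(A ^ k) (C x)‖ ^ 2 - ‖(A ^ k) (D x)‖ ^ 2 : ℝ) : ℂ) := fun k x => by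
    have key : ∀ G : E →L[ℂ] E, IsSelfAdjoint G → Commute G A →
        star (A ^ k * G) * (A ^ k * G) = A ^ (2 * k) * (G * G) := fun G hG hGA => by
      rw [star_mul, hAk, hG.star_eq, mul_assoc, ← mul_assoc (A ^ k), hdouble, ← mul_assoc,
        (hGA.pow_right (2 * k)).eq, mul_assoc]
    have e1 := inner_star_mul_self_apply (A ^ k * C) x
    have e2 := inner_star_mul_self_apply (A ^ k * D) x
    rw [key C hC hCA] at e1
    rw [key D hD hDA] at e2
    rw [Complex.ofReal_sub, ← mul_apply_eq_comp, ← mul_apply_eq_comp, ← e1, ← e2,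
      ← inner_sub_right, ← sub_apply, ← mul_sub, hCD, pow_succ]
  have hsummable : ∀ (k : ℕ) (G : E →L[ℂ] E), (Summable fun i => ‖G (b i)‖ ^ 2) →
      Summable fun i => ‖(A ^ k) (G (b i))‖ ^ 2 := fun k G hG =>
    hG.of_nonneg_of_le (fun i => sq_nonneg _) fun i =>
      pow_le_pow_left₀ (norm_nonneg _) (h.norm_pow_apply_le k _) 2
  have hsummableB : ∀ (k : ℕ) (G : E →L[ℂ] E), (Summable fun i => ‖G (b i)‖ ^ 2) →
      Summable fun i => ‖(B * A ^ k * G) (b i)‖ ^ 2 := fun k G hG =>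
    (hsummable k G hG).of_nonneg_of_le (fun i => sq_nonneg _) fun i => by
      rw [mul_apply_eq_comp, mul_apply_eq_comp, ← h.norm_sq_add_norm_sq ((A ^ k) (G (b i)))]
      exact le_add_of_nonneg_left (sq_nonneg _)
  let t : ℕ → ℝ := fun k => ∑' i, (‖(A ^ k) (C (b i))‖ ^ 2 - ‖(A ^ k) (D (b i))‖ ^ 2)
  -- the trace of `A ^ (2 * k + 1) * (B * B)` vanishes
  have hzero : ∀ k : ℕ, ∑' i, (‖(B * A ^ k * C) (b i)‖ ^ 2 - ‖(B * A ^ k * D) (b i)‖ ^ 2) = 0 := by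
    intro k
    have q1 := (hsummableB k C sC).hasSum
    have q2 := (hsummableB k D sD).hasSum
    have q3 := (hasSum_norm_sq_star b b q1).sub (hasSum_norm_sq_star b b q2)
    have q4 := q1.sub q2
    have hneg : ∀ i, ‖(star (B * A ^ k * C)) (b i)‖ ^ 2 - ‖(star (B * A ^ k * D)) (b i)‖ ^ 2 =
        -(‖(B * A ^ k * C) (b i)‖ ^ 2 - ‖(B * A ^ k * D) (b i)‖ ^ 2) := fun i => by
      have k1 : ∀ G : E →L[ℂ] E, IsSelfAdjoint G → Commute G A →
          star (B * A ^ k * G) * (B * A ^ k * G) = A ^ (2 * k) * (G * G) * (B * B) := by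
        intro G hG hGA
        have hGB : Commute G (B * B) := by
          rw [hBB]; exact (Commute.one_right G).sub_right (hGA.mul_right hGA)
        have hAB : Commute (A ^ k) (B * B) := by
          rw [hBB]
          exact (Commute.one_right _).sub_right
            (((Commute.refl A).pow_left k).mul_right ((Commute.refl A).pow_left k))
        calc star (B * A ^ k * G) * (B * A ^ k * G)
            = G * A ^ k * (B * B) * A ^ k * G := by
              rw [star_mul, star_mul, hAk, hG.star_eq, h.right_selfAdjoint.star_eq]
              simp only [mul_assoc]
          _ = G * (A ^ k * A ^ k) * ((B * B) * G) := by
              rw [mul_assoc _ (B * B), ← hAB.eq]; simp only [mul_assoc]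
          _ = A ^ (2 * k) * (G * G) * (B * B) := by
              rw [hdouble, (hGA.pow_right (2 * k)).eq, ← hGB.eq]; simp only [mul_assoc]
      have k2 : ∀ G : E →L[ℂ] E, IsSelfAdjoint G → Commute G A →
          star (star (B * A ^ k * G)) * star (B * A ^ k * G) =
            B * (A ^ (2 * k) * (G * G)) * B := by
        intro G hG hGA
        calc star (star (B * A ^ k * G)) * star (B * A ^ k * G)
            = B * (A ^ k * (G * G) * A ^ k) * B := by
              rw [star_star, star_mul, star_mul, hAk, hG.star_eq, h.right_selfAdjoint.star_eq]
              simp only [mul_assoc]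
          _ = B * (A ^ (2 * k) * (G * G)) * B := by
              rw [mul_assoc (A ^ k), ((hGA.mul_left hGA).pow_right k).eq, ← mul_assoc (A ^ k),
                hdouble]
      have e1 := inner_star_mul_self_apply (B * A ^ k * C) (b i)
      have e2 := inner_star_mul_self_apply (B * A ^ k * D) (b i)
      have e3 := inner_star_mul_self_apply (star (B * A ^ k * C)) (b i)
      have e4 := inner_star_mul_self_apply (star (B * A ^ k * D)) (b i)
      rw [k1 C hC hCA] at e1
      rw [k1 D hD hDA] at e2
      rw [k2 C hC hCA] at e3
      rw [k2 D hD hDA] at e4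
      have d1 : A ^ (2 * k) * (C * C) * (B * B) - A ^ (2 * k) * (D * D) * (B * B) =
          A ^ (2 * k + 1) * (B * B) := by
        rw [← sub_mul, ← mul_sub, hCD, pow_succ]
      have d2 : B * (A ^ (2 * k) * (C * C)) * B - B * (A ^ (2 * k) * (D * D)) * B =
          -(A ^ (2 * k + 1) * (B * B)) := by
        rw [← sub_mul, ← mul_sub, ← mul_sub, hCD, ← pow_succ, h.mul_odd_pow, neg_mul, mul_assoc]
      have : ((‖(star (B * A ^ k * C)) (b i)‖ ^ 2 - ‖(star (B * A ^ k * D)) (b i)‖ ^ 2 : ℝ) : ℂ) =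
          ((-(‖(B * A ^ k * C) (b i)‖ ^ 2 - ‖(B * A ^ k * D) (b i)‖ ^ 2) : ℝ) : ℂ) := by
        rw [Complex.ofReal_neg, Complex.ofReal_sub, Complex.ofReal_sub, ← e1, ← e2, ← e3, ← e4,
          ← inner_sub_right, ← inner_sub_right, ← sub_apply,
          ← sub_apply, d1, d2, neg_apply, inner_neg_right]
      exact_mod_cast this
    simp only [hneg] at q3
    have q5 := q4.neg.unique q3
    rw [q4.tsum_eq]
    exact self_eq_neg.1 q5.symm
  have hsC := fun k => hsummable k C sC
  have hsD := fun k => hsummable k D sD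
  have hstep : ∀ k, t (k + 1) = t k := fun k => by
    have hz := hzero k
    have hsucc : ∀ G : E →L[ℂ] E, ∀ i, ‖(B * A ^ k * G) (b i)‖ ^ 2 =
        ‖(A ^ k) (G (b i))‖ ^ 2 - ‖(A ^ (k + 1)) (G (b i))‖ ^ 2 := fun G i => by
      rw [mul_apply_eq_comp, mul_apply_eq_comp, pow_succ' A k, mul_apply_eq_comp,
        ← h.norm_sq_add_norm_sq ((A ^ k) (G (b i)))]
      ring
    simp only [hsucc, sub_sub_sub_comm] at hz
    rw [((hsC k).sub (hsD k)).tsum_sub ((hsC (k + 1)).sub (hsD (k + 1)))] at hz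
    exact (sub_eq_zero.1 hz).symm
  have hconst : ∀ k, t k = t 0 := fun k => by
    induction k with
    | zero => rfl
    | succ k ih => rw [hstep, ih]
  -- the limit of the traces
  have hlim : Filter.Tendsto t Filter.atTop
      (nhds (∑' i, (‖N₁.starProjection (b i)‖ ^ 2 - ‖N₂.starProjection (b i)‖ ^ 2))) := by
    refine tendsto_tsum_of_dominated_convergence (sC.add sD) (fun i => ?_)
      (Filter.Eventually.of_forall fun k i => ?_)
    · have hp := h.tendsto_pow_apply hN₁ hN₂ (b i)
      have hp' : Filter.Tendsto (fun k => (⟪b i, (A ^ (2 * k + 1)) (b i)⟫_ℂ).re) Filter.atTop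
          (nhds (⟪b i, N₁.starProjection (b i) - N₂.starProjection (b i)⟫_ℂ).re) :=
        (Complex.continuous_re.tendsto _).comp (Filter.Tendsto.inner tendsto_const_nhds hp)
      have hproj : ∀ N : Submodule ℂ E, [N.HasOrthogonalProjection] → ∀ x : E,
          ⟪x, N.starProjection x⟫_ℂ = ((‖N.starProjection x‖ ^ 2 : ℝ) : ℂ) := by
        intro N _ x
        rw [← inner_star_mul_self_apply, (isSelfAdjoint_starProjection N).star_eq,
          N.isIdempotentElem_starProjection.eq]
      simp only [hform, Complex.ofReal_re, inner_sub_right, hproj, ← Complex.ofReal_sub] at hp'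
      exact hp'
    · rw [Real.norm_eq_abs]
      have b1 := pow_le_pow_left₀ (norm_nonneg _) (h.norm_pow_apply_le k (C (b i))) 2
      have b2 := pow_le_pow_left₀ (norm_nonneg _) (h.norm_pow_apply_le k (D (b i))) 2
      have b3 := sq_nonneg ‖(A ^ k) (C (b i))‖
      have b4 := sq_nonneg ‖(A ^ k) (D (b i))‖
      rw [abs_le]
      constructor <;> linarith
  have hval : t 0 = (Module.finrank ℂ N₁ : ℝ) - Module.finrank ℂ N₂ := by
    have p := (hasSum_norm_starProjection_sq b N₁).sub (hasSum_norm_starProjection_sq b N₂)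
    rw [p.tsum_eq] at hlim
    exact tendsto_nhds_unique (tendsto_const_nhds.congr fun k => (hconst k).symm) hlim
  have hfin : HasSum (fun i => ‖(A ^ 0) (C (b i))‖ ^ 2 - ‖(A ^ 0) (D (b i))‖ ^ 2) (t 0) :=
    ((hsC 0).sub (hsD 0)).hasSum
  rw [hval, ← Complex.hasSum_ofReal] at hfin
  have hA1 : A = A ^ (2 * 0 + 1) := by simp
  have hfun : (fun i => ⟪b i, A (b i)⟫_ℂ) =
      fun i => ((‖(A ^ 0) (C (b i))‖ ^ 2 - ‖(A ^ 0) (D (b i))‖ ^ 2 : ℝ) : ℂ) := by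
    ext i
    rw [← hform 0 (b i), ← hA1]
  rw [hfun]
  convert hfin using 1
  push_cast
  rfl

end IsAnticommutingPair

end Trace

/-! ### The spectral measure of a module -/

section SpectralMeasure

open scoped CompactlySupported

/-- A compactly supported real function as an element of `C₀(X)`. -/
def complexify {X : Type v} [TopologicalSpace X] (f : C_c(X, ℝ)) : C₀(X, ℂ) where
  toFun x := (f x : ℂ)
  continuous_toFun := Complex.continuous_ofReal.comp f.continuous
  zero_at_infty' := (f.hasCompactSupport.comp_left (g := Complex.ofReal)
    Complex.ofReal_zero).is_zero_at_infty

@[simp]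
theorem complexify_apply {X : Type v} [TopologicalSpace X] (f : C_c(X, ℝ)) (x : X) :
    complexify f x = (f x : ℂ) := rfl

theorem star_complexify {X : Type v} [TopologicalSpace X] (f : C_c(X, ℝ)) :
    star (complexify f) = complexify f := by
  ext x
  simp

theorem norm_complexify_le_one {X : Type v} [TopologicalSpace X] {f : C_c(X, ℝ)}
    (hf : ∀ x, f x ∈ Set.Icc (0 : ℝ) 1) : ‖complexify f‖ ≤ 1 := by
  rw [← ZeroAtInftyContinuousMap.norm_toBCF_eq_norm]
  refine (BoundedContinuousFunction.norm_le zero_le_one).2 fun x => ?_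
  have : ‖((f x : ℝ) : ℂ)‖ ≤ 1 := by
    rw [Complex.norm_real, Real.norm_eq_abs, abs_of_nonneg (hf x).1]; exact (hf x).2
  exact this

theorem exists_compactlySupported_eq_one {X : Type v} [MetricSpace X] [ProperSpace X] {K U : Set X}
    (hK : IsCompact K) (hU : IsOpen U) (hKU : K ⊆ U) :
    ∃ f : C_c(X, ℝ), (∀ x ∈ K, f x = 1) ∧ tsupport f ⊆ U ∧ ∀ x, f x ∈ Set.Icc (0 : ℝ) 1 := by
  obtain ⟨f, h1, h2, h3, h4⟩ := exists_continuousMap_one_of_isCompact_subset_isOpen hK hU hKU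
  exact ⟨⟨f, h2⟩, h1, h3, h4⟩

variable {X : Type v} [MetricSpace X]
variable {H : Type u} [NormedAddCommGroup H] [InnerProductSpace ℂ H] [CompleteSpace H]
variable (ρ : C₀(X, ℂ) →⋆ₙₐ[ℂ] (H →L[ℂ] H))

theorem essentialSubspace_mono {U V : Set X} (h : U ⊆ V) :
    essentialSubspace ρ U ≤ essentialSubspace ρ V := by
  refine Submodule.topologicalClosure_mono (Submodule.span_mono ?_)
  rintro η ⟨f, hf, ξ, rfl⟩
  exact ⟨f, fun x hx => hf x fun hxU => hx (h hxU), ξ, rfl⟩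

theorem apply_mem_essentialSubspace {U : Set X} {f : C₀(X, ℂ)} (hf : ∀ x ∉ U, f x = 0) (ξ : H) :
    ρ f ξ ∈ essentialSubspace ρ U :=
  Submodule.le_topologicalClosure _ (Submodule.subset_span ⟨f, hf, ξ, rfl⟩)

theorem spectralSubspace_mono {V W : Set X} (h : V ⊆ W) :
    spectralSubspace ρ V ≤ spectralSubspace ρ W :=
  le_iInf fun U => iInf_le_of_le ⟨U.1, U.2.1, h.trans U.2.2⟩ le_rfl

theorem spectralSubspace_of_isOpen {U : Set X} (hU : IsOpen U) :
    spectralSubspace ρ U = essentialSubspace ρ U :=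
  le_antisymm (iInf_le_of_le ⟨U, hU, subset_rfl⟩ le_rfl)
    (le_iInf fun V => essentialSubspace_mono ρ V.2.2)

theorem isSelfAdjoint_chi (W : Set X) : IsSelfAdjoint (chi ρ W) := isSelfAdjoint_starProjection _

theorem star_chi (W : Set X) : star (chi ρ W) = chi ρ W := (isSelfAdjoint_chi ρ W).star_eq

theorem chi_mul_self (W : Set X) : chi ρ W * chi ρ W = chi ρ W :=
  (Submodule.isIdempotentElem_starProjection _).eq

theorem chi_mul_of_subset {V W : Set X} (h : V ⊆ W) : chi ρ W * chi ρ V = chi ρ V := by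
  ext ξ
  exact Submodule.starProjection_eq_self_iff.2
    (spectralSubspace_mono ρ h (Submodule.starProjection_apply_mem _ _))

theorem chi_mul_of_subset_right {V W : Set X} (h : V ⊆ W) : chi ρ V * chi ρ W = chi ρ V := by
  have := congrArg star (chi_mul_of_subset ρ h)
  rwa [star_mul, star_chi, star_chi] at this

theorem inner_chi_apply (W : Set X) (ξ : H) :
    ⟪ξ, chi ρ W ξ⟫_ℂ = ((‖chi ρ W ξ‖ ^ 2 : ℝ) : ℂ) := by
  rw [← inner_star_mul_self_apply, star_chi, chi_mul_self]

theorem norm_chi_sq_mono {V W : Set X} (h : V ⊆ W) (ξ : H) :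
    ‖chi ρ V ξ‖ ^ 2 ≤ ‖chi ρ W ξ‖ ^ 2 := by
  rw [← chi_mul_of_subset_right ρ h, mul_apply_eq_comp]
  gcongr
  exact Submodule.norm_starProjection_apply_le _ _

theorem chi_univ (hρ : IsNondegenerate ρ) : chi ρ Set.univ = 1 := by
  ext ξ
  refine Submodule.starProjection_eq_self_iff.2 ?_
  rw [spectralSubspace_of_isOpen ρ isOpen_univ, show essentialSubspace ρ Set.univ = ⊤ from hρ]
  trivial

/-- `χ_W` is the strong limit of the projections `χ_U` over the open sets `U ⊇ W`. -/
theorem exists_isOpen_norm_chi_sq_le (W : Set X) (ξ : H) {ε : ℝ} (hε : 0 < ε) :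
    ∃ U, IsOpen U ∧ W ⊆ U ∧ ‖chi ρ U ξ‖ ^ 2 ≤ ‖chi ρ W ξ‖ ^ 2 + ε := by
  let ι := {U : Set X // IsOpen U ∧ W ⊆ U}ᵒᵈ
  let K : ι → Submodule ℂ H := fun U => (spectralSubspace ρ (OrderDual.ofDual U).1)ᗮ
  have hK : Monotone K := fun U V hUV => Submodule.orthogonal_le (spectralSubspace_mono ρ hUV)
  have : Nonempty ι := ⟨OrderDual.toDual ⟨Set.univ, isOpen_univ, Set.subset_univ _⟩⟩
  have : IsDirectedOrder ι := ⟨fun U V => ⟨OrderDual.toDual ⟨(OrderDual.ofDual U).1 ∩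
    (OrderDual.ofDual V).1, (OrderDual.ofDual U).2.1.inter (OrderDual.ofDual V).2.1,
    Set.subset_inter (OrderDual.ofDual U).2.2 (OrderDual.ofDual V).2.2⟩,
    fun _ hx => hx.1, fun _ hx => hx.2⟩⟩
  have hsup : (⨆ U, K U).topologicalClosure = (spectralSubspace ρ W)ᗮ := by
    rw [← Submodule.orthogonal_orthogonal_eq_closure, ← Submodule.iInf_orthogonal]
    congr 1
    have h1 : ∀ U : ι, (K U)ᗮ = essentialSubspace ρ (OrderDual.ofDual U).1 := fun U => by
      rw [Submodule.orthogonal_orthogonal, spectralSubspace_of_isOpen ρ (OrderDual.ofDual U).2.1]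
    simp only [h1]
    rfl
  have hlim := Submodule.starProjection_tendsto_closure_iSup K hK ξ
  have hlim' : Filter.Tendsto (fun U : ι => chi ρ (OrderDual.ofDual U).1 ξ) Filter.atTop
      (nhds (chi ρ W ξ)) := by
    have h2 := hlim.const_sub ξ
    have h3 : ∀ U : ι, ξ - (K U).starProjection ξ = chi ρ (OrderDual.ofDual U).1 ξ := fun U => by
      simp only [K, Submodule.starProjection_orthogonal', sub_apply, one_apply_eq_self,
        sub_sub_cancel]
      rfl
    have h4 : ξ - (⨆ U, K U).topologicalClosure.starProjection ξ = chi ρ W ξ := by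
      simp only [hsup, Submodule.starProjection_orthogonal', sub_apply, one_apply_eq_self,
        sub_sub_cancel]
      rfl
    simpa only [h3, h4] using h2
  have hev := (hlim'.norm.pow 2).eventually_le_const (lt_add_of_pos_right _ hε)
  obtain ⟨U, hU⟩ := hev.exists
  exact ⟨(OrderDual.ofDual U).1, (OrderDual.ofDual U).2.1, (OrderDual.ofDual U).2.2, hU⟩

theorem chi_mul_apply {U : Set X} (hU : IsOpen U) {f : C₀(X, ℂ)} (hf : ∀ x ∉ U, f x = 0) :
    chi ρ U * ρ f = ρ f := by
  ext ξ
  refine Submodule.starProjection_eq_self_iff.2 ?_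
  rw [spectralSubspace_of_isOpen ρ hU]
  exact apply_mem_essentialSubspace ρ hf ξ

theorem apply_mul_chi {U : Set X} (hU : IsOpen U) {f : C₀(X, ℂ)} (hf : ∀ x ∉ U, f x = 0) :
    ρ f * chi ρ U = ρ f := by
  have h := congrArg star (chi_mul_apply ρ hU (f := star f) fun x hx => by simp [hf x hx])
  rwa [star_mul, star_chi, ← map_star, star_star] at h

/-- Functions in `C₀(X)` that are `1` on a large compact subset of `U` act almost as the identity
on a given vector of the essential subspace. -/
theorem exists_compact_norm_sub_le {U : Set X} {ξ : H} (hξ : ξ ∈ essentialSubspace ρ U)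
    {ε : ℝ} (hε : 0 < ε) :
    ∃ K ⊆ U, IsCompact K ∧ ∀ f : C_c(X, ℝ), (∀ x, f x ∈ Set.Icc (0 : ℝ) 1) → (∀ x ∈ K, f x = 1) →
      ‖ρ (complexify f) ξ - ξ‖ ≤ ε := by
  have hspan : ∀ ξ ∈ Submodule.span ℂ {η | ∃ f : C₀(X, ℂ), (∀ x ∉ U, f x = 0) ∧
      ∃ ξ : H, η = ρ f ξ}, ∀ ε : ℝ, 0 < ε → ∃ K ⊆ U, IsCompact K ∧ ∀ f : C_c(X, ℝ),
        (∀ x, f x ∈ Set.Icc (0 : ℝ) 1) → (∀ x ∈ K, f x = 1) → ‖ρ (complexify f) ξ - ξ‖ ≤ ε := by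
    intro ξ hξ
    induction hξ using Submodule.span_induction with
    | mem η hη =>
      obtain ⟨g, hg, ζ, rfl⟩ := hη
      intro ε hε
      set δ := ε / (‖ζ‖ + 1) with hδ
      have hζ : 0 < ‖ζ‖ + 1 := by positivity
      have hδ0 : 0 < δ := by positivity
      have hcoc : {x | ‖g x‖ < δ} ∈ Filter.cocompact X := by
        have := g.zero_at_infty'.norm
        rw [norm_zero] at this
        exact this.eventually_lt_const hδ0
      obtain ⟨K', hK', hK'sub⟩ := Filter.mem_cocompact.1 hcoc
      refine ⟨{x | δ ≤ ‖g x‖}, fun x hx => ?_, ?_, fun f hf hf1 => ?_⟩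
      · by_contra hxU
        have hx' : δ ≤ ‖g x‖ := hx
        rw [hg x hxU, norm_zero] at hx'
        exact absurd hδ0 (not_lt.2 hx')
      · refine hK'.of_isClosed_subset (isClosed_le continuous_const g.continuous.norm)
          fun x hx => ?_
        by_contra hxK
        exact absurd (show ‖g x‖ < δ from hK'sub hxK) (not_lt.2 hx)
      · have hle : ‖complexify f * g - g‖ ≤ δ := by
          rw [← ZeroAtInftyContinuousMap.norm_toBCF_eq_norm]
          refine (BoundedContinuousFunction.norm_le hδ0.le).2 fun x => ?_
          change ‖(f x : ℂ) * g x - g x‖ ≤ δ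
          by_cases hx : δ ≤ ‖g x‖
          · rw [hf1 x hx]; simpa using hδ0.le
          · rw [show (f x : ℂ) * g x - g x = ((f x - 1 : ℝ) : ℂ) * g x by push_cast; ring, norm_mul,
              Complex.norm_real, Real.norm_eq_abs]
            have h1 : |f x - 1| ≤ 1 := by
              rw [abs_le]; constructor <;> linarith [(hf x).1, (hf x).2]
            calc |f x - 1| * ‖g x‖ ≤ 1 * ‖g x‖ := by gcongr
              _ ≤ δ := by rw [one_mul]; exact (not_le.1 hx).le
        have heq : ρ (complexify f) (ρ g ζ) - ρ g ζ = ρ (complexify f * g - g) ζ := by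
          rw [map_sub, map_mul]; rfl
        rw [heq]
        calc ‖ρ (complexify f * g - g) ζ‖ ≤ ‖ρ (complexify f * g - g)‖ * ‖ζ‖ :=
              ContinuousLinearMap.le_opNorm _ _
          _ ≤ δ * (‖ζ‖ + 1) := by
              gcongr
              · exact (NonUnitalStarAlgHom.norm_apply_le ρ _).trans hle
              · linarith
          _ = ε := by rw [hδ]; field_simp
    | zero => exact fun ε hε => ⟨∅, Set.empty_subset _, isCompact_empty, fun f _ _ => by
        simpa using hε.le⟩
    | add x y _ _ hx hy =>
      intro ε hε
      obtain ⟨K, hKU, hK, h1⟩ := hx (ε / 2) (half_pos hε)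
      obtain ⟨L, hLU, hL, h2⟩ := hy (ε / 2) (half_pos hε)
      refine ⟨K ∪ L, Set.union_subset hKU hLU, hK.union hL, fun f hf hf1 => ?_⟩
      rw [map_add, add_sub_add_comm]
      refine (norm_add_le _ _).trans ?_
      have := h1 f hf fun x hx => hf1 x (Or.inl hx)
      have := h2 f hf fun x hx => hf1 x (Or.inr hx)
      linarith
    | smul a x _ hx =>
      intro ε hε
      obtain ⟨K, hKU, hK, h1⟩ := hx (ε / (‖a‖ + 1)) (by positivity)
      refine ⟨K, hKU, hK, fun f hf hf1 => ?_⟩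
      rw [map_smul, ← smul_sub, norm_smul]
      calc ‖a‖ * ‖ρ (complexify f) x - x‖ ≤ (‖a‖ + 1) * (ε / (‖a‖ + 1)) := by
            gcongr
            · linarith
            · exact h1 f hf hf1
        _ = ε := by field_simp
  obtain ⟨η, hη, hd⟩ := Metric.mem_closure_iff.1 hξ (ε / 3) (by positivity)
  obtain ⟨K, hKU, hK, h1⟩ := hspan η hη (ε / 3) (by positivity)
  refine ⟨K, hKU, hK, fun f hf hf1 => ?_⟩
  have h2 := h1 f hf hf1
  rw [dist_eq_norm] at hd
  have h3 : ‖ρ (complexify f) (ξ - η)‖ ≤ ‖ξ - η‖ := by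
    refine (ContinuousLinearMap.le_opNorm _ _).trans ?_
    refine mul_le_of_le_one_left (norm_nonneg _) ?_
    exact (NonUnitalStarAlgHom.norm_apply_le ρ _).trans (norm_complexify_le_one hf)
  have heq : ρ (complexify f) ξ - ξ =
      ρ (complexify f) (ξ - η) + (ρ (complexify f) η - η) - (ξ - η) := by
    rw [map_sub]; abel
  rw [heq]
  refine (norm_sub_le _ _).trans ?_
  have := norm_add_le (ρ (complexify f) (ξ - η)) (ρ (complexify f) η - η)
  linarith

theorem inner_apply_complexify_nonneg {f : C_c(X, ℝ)} (hf : 0 ≤ f) (ξ : H) :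
    0 ≤ (⟪ξ, ρ (complexify f) ξ⟫_ℂ).re := by
  let g : C_c(X, ℝ) := ⟨⟨fun x => √(f x), f.continuous.sqrt⟩,
    f.hasCompactSupport.comp_left (g := Real.sqrt) Real.sqrt_zero⟩
  have hg : complexify f = star (complexify g) * complexify g := by
    rw [star_complexify]
    ext x
    change ((f x : ℝ) : ℂ) = ((√(f x) : ℝ) : ℂ) * ((√(f x) : ℝ) : ℂ)
    rw [← Complex.ofReal_mul, Real.mul_self_sqrt (hf x)]
  rw [hg, map_mul, map_star, inner_star_mul_self_apply, Complex.ofReal_re]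
  positivity

/-- The positive functional `f ↦ ⟨ξ, f ξ⟩`. -/
def vectorFunctional (ξ : H) : C_c(X, ℝ) →ₚ[ℝ] ℝ :=
  PositiveLinearMap.mk₀
    { toFun := fun f => (⟪ξ, ρ (complexify f) ξ⟫_ℂ).re
      map_add' := fun f g => by
        have : complexify (f + g) = complexify f + complexify g := by ext x; simp
        rw [this, map_add, add_apply, inner_add_right, Complex.add_re]
      map_smul' := fun a f => by
        have : complexify (a • f) = (a : ℂ) • complexify f := by ext x; simp
        rw [this, map_smul, smul_apply, inner_smul_right, Complex.re_ofReal_mul]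
        rfl }
    fun f hf => inner_apply_complexify_nonneg ρ hf ξ

theorem vectorFunctional_apply (ξ : H) (f : C_c(X, ℝ)) :
    vectorFunctional ρ ξ f = (⟪ξ, ρ (complexify f) ξ⟫_ℂ).re := rfl

theorem vectorFunctional_eq {U : Set X} (hU : IsOpen U) (ξ : H) {f : C_c(X, ℝ)}
    (hf : tsupport f ⊆ U) :
    vectorFunctional ρ ξ f = (⟪chi ρ U ξ, ρ (complexify f) (chi ρ U ξ)⟫_ℂ).re := by
  have hz : ∀ x ∉ U, complexify f x = 0 := fun x hx => by
    rw [complexify_apply, image_eq_zero_of_notMem_tsupport fun h => hx (hf h), Complex.ofReal_zero]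
  have h1 : chi ρ U * (ρ (complexify f) * chi ρ U) = ρ (complexify f) := by
    rw [apply_mul_chi ρ hU hz, chi_mul_apply ρ hU hz]
  rw [vectorFunctional_apply]
  nth_rw 1 [← h1]
  rw [mul_apply_eq_comp, mul_apply_eq_comp, ← ContinuousLinearMap.adjoint_inner_left,
    ← ContinuousLinearMap.star_eq_adjoint, star_chi]

theorem vectorFunctional_le {U : Set X} (hU : IsOpen U) (ξ : H) {f : C_c(X, ℝ)}
    (hf : tsupport f ⊆ U) (hf1 : ∀ x, f x ∈ Set.Icc (0 : ℝ) 1) :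
    vectorFunctional ρ ξ f ≤ ‖chi ρ U ξ‖ ^ 2 := by
  rw [vectorFunctional_eq ρ hU ξ hf]
  refine (Complex.re_le_norm _).trans ((norm_inner_le_norm _ _).trans ?_)
  rw [sq]
  gcongr
  refine (ContinuousLinearMap.le_opNorm _ _).trans (mul_le_of_le_one_left (norm_nonneg _) ?_)
  exact (NonUnitalStarAlgHom.norm_apply_le ρ _).trans (norm_complexify_le_one hf1)

variable [ProperSpace X]

theorem exists_le_vectorFunctional {U : Set X} (hU : IsOpen U) (ξ : H) {ε : ℝ} (hε : 0 < ε) :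
    ∃ f : C_c(X, ℝ), tsupport f ⊆ U ∧ (∀ x, f x ∈ Set.Icc (0 : ℝ) 1) ∧
      ‖chi ρ U ξ‖ ^ 2 ≤ vectorFunctional ρ ξ f + ε := by
  set η := chi ρ U ξ with hη
  have hmem : η ∈ essentialSubspace ρ U := by
    rw [← spectralSubspace_of_isOpen ρ hU]
    exact Submodule.starProjection_apply_mem _ _
  obtain ⟨K, hKU, hK, h⟩ := exists_compact_norm_sub_le ρ hmem
    (show 0 < ε / (‖η‖ + 1) by positivity)
  obtain ⟨f, hf1, hfU, hf⟩ := exists_compactlySupported_eq_one hK hU hKU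
  refine ⟨f, hfU, hf, ?_⟩
  rw [vectorFunctional_eq ρ hU ξ hfU, ← hη]
  have h1 : ‖η‖ ^ 2 = (⟪η, ρ (complexify f) η⟫_ℂ).re - (⟪η, ρ (complexify f) η - η⟫_ℂ).re := by
    rw [inner_sub_right, Complex.sub_re, sub_sub_cancel, inner_self_eq_norm_sq_to_K]
    norm_cast
  have h2 : -(⟪η, ρ (complexify f) η - η⟫_ℂ).re ≤ ε := by
    refine (neg_le_abs _).trans ((Complex.abs_re_le_norm _).trans
      ((norm_inner_le_norm _ _).trans ?_))
    calc ‖η‖ * ‖ρ (complexify f) η - η‖ ≤ (‖η‖ + 1) * (ε / (‖η‖ + 1)) := by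
          gcongr
          · linarith
          · exact h f hf hf1
      _ = ε := by field_simp
  linarith

variable [MeasurableSpace X] [BorelSpace X]

/-- The scalar spectral measure of a vector. -/
def vectorMeasure (ξ : H) : MeasureTheory.Measure X :=
  RealRMK.rieszMeasure (vectorFunctional ρ ξ)

theorem vectorMeasure_of_isOpen (ξ : H) {U : Set X} (hU : IsOpen U) :
    vectorMeasure ρ ξ U = ENNReal.ofReal (‖chi ρ U ξ‖ ^ 2) := by
  apply le_antisymm
  · have : (vectorMeasure ρ ξ).Regular := RealRMK.regular_rieszMeasure _
    rw [hU.measure_eq_iSup_isCompact]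
    refine iSup_le fun K => iSup_le fun hKU => iSup_le fun hK => ?_
    obtain ⟨f, hf1, hfU, hf⟩ := exists_compactlySupported_eq_one hK hU hKU
    exact (RealRMK.rieszMeasure_le_of_eq_one _ (fun x => (hf x).1) hK hf1).trans
      (ENNReal.ofReal_le_ofReal (vectorFunctional_le ρ hU ξ hfU hf))
  · refine ENNReal.le_of_forall_pos_le_add fun ε hε _ => ?_
    obtain ⟨f, hfU, hf, hle⟩ := exists_le_vectorFunctional ρ hU ξ (ε := ε) (by exact_mod_cast hε)
    refine (ENNReal.ofReal_le_ofReal hle).trans (ENNReal.ofReal_add_le.trans ?_)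
    rw [ENNReal.ofReal_coe_nnreal]
    gcongr
    exact RealRMK.le_rieszMeasure_tsupport_subset _ (fun x => hf x) hfU

theorem vectorMeasure_apply (ξ : H) (W : Set X) :
    vectorMeasure ρ ξ W = ENNReal.ofReal (‖chi ρ W ξ‖ ^ 2) := by
  have : (vectorMeasure ρ ξ).Regular := RealRMK.regular_rieszMeasure _
  apply le_antisymm
  · refine ENNReal.le_of_forall_pos_le_add fun ε hε _ => ?_
    obtain ⟨U, hU, hWU, hle⟩ := exists_isOpen_norm_chi_sq_le ρ W ξ (ε := ε) (by exact_mod_cast hε)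
    refine (MeasureTheory.measure_mono hWU).trans ?_
    rw [vectorMeasure_of_isOpen ρ ξ hU]
    refine (ENNReal.ofReal_le_ofReal hle).trans (ENNReal.ofReal_add_le.trans ?_)
    rw [ENNReal.ofReal_coe_nnreal]
  · rw [W.measure_eq_iInf_isOpen]
    refine le_iInf fun U => le_iInf fun hWU => le_iInf fun hU => ?_
    rw [vectorMeasure_of_isOpen ρ ξ hU]
    exact ENNReal.ofReal_le_ofReal (norm_chi_sq_mono ρ hWU ξ)

theorem chi_union {V W : Set X} (hVW : Disjoint V W) (hW : MeasurableSet W) :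
    chi ρ (V ∪ W) = chi ρ V + chi ρ W := by
  have h : ∀ ξ : H, ‖chi ρ (V ∪ W) ξ‖ ^ 2 = ‖chi ρ V ξ‖ ^ 2 + ‖chi ρ W ξ‖ ^ 2 := fun ξ => by
    have := MeasureTheory.measure_union (μ := vectorMeasure ρ ξ) hVW hW
    rw [vectorMeasure_apply, vectorMeasure_apply, vectorMeasure_apply,
      ← ENNReal.ofReal_add (sq_nonneg _) (sq_nonneg _),
      ENNReal.ofReal_eq_ofReal_iff (sq_nonneg _) (by positivity)] at this
    exact this
  have key : (chi ρ (V ∪ W) : H →ₗ[ℂ] H) = (chi ρ V + chi ρ W : H →L[ℂ] H) := by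
    rw [← ext_inner_map]
    intro ξ
    rw [← inner_conj_symm, ← inner_conj_symm _ ξ]
    congr 1
    change ⟪ξ, chi ρ (V ∪ W) ξ⟫_ℂ = ⟪ξ, chi ρ V ξ + chi ρ W ξ⟫_ℂ
    rw [inner_add_right, inner_chi_apply, inner_chi_apply, inner_chi_apply, h ξ,
      Complex.ofReal_add]
  exact ContinuousLinearMap.coe_injective key

theorem chi_compl (hρ : IsNondegenerate ρ) {W : Set X} (hW : MeasurableSet W) :
    chi ρ Wᶜ = 1 - chi ρ W := by
  rw [eq_sub_iff_add_eq, ← chi_union ρ disjoint_compl_left hW, Set.compl_union_self,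
    chi_univ ρ hρ]

theorem chi_mul_of_disjoint (hρ : IsNondegenerate ρ) {V W : Set X} (hW : MeasurableSet W)
    (hVW : Disjoint V W) : chi ρ V * chi ρ W = 0 := by
  have h := chi_mul_of_subset_right ρ (hVW.subset_compl_right)
  rw [chi_compl ρ hρ hW, mul_sub, mul_one, sub_eq_self] at h
  exact h

theorem chi_inter (hρ : IsNondegenerate ρ) {V W : Set X} (hV : MeasurableSet V)
    (hW : MeasurableSet W) : chi ρ (V ∩ W) = chi ρ V * chi ρ W := by
  have h := chi_union ρ (V := V ∩ W) (W := V \ W)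
    (Set.disjoint_sdiff_right.mono_left Set.inter_subset_right) (hV.diff hW)
  rw [Set.inter_union_sdiff] at h
  rw [h, add_mul, chi_mul_of_subset_right ρ Set.inter_subset_right,
    chi_mul_of_disjoint ρ hρ hW Set.disjoint_sdiff_left, add_zero]

end SpectralMeasure

/-! ### Thickenings -/

section Thickening

variable {X : Type v} [MetricSpace X]

theorem cthickening_subset_neighborhood {r s : ℝ} (hr : 0 ≤ r) (h : r < s) (Y : Set X) :
    Metric.cthickening r Y ⊆ neighborhood s Y := fun x hx => by
  obtain ⟨y, hy, hd⟩ := Metric.mem_thickening_iff.1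
    (Metric.cthickening_subset_thickening' (hr.trans_lt h) h Y hx)
  exact ⟨y, hy, hd.le⟩

theorem mem_coarseBoundary {Y Z : Set X} {r s : ℝ} (hr : 0 < r) (hs : 0 < s)
    (h1 : Z ⊆ neighborhood r Y) (h2 : Z ⊆ neighborhood s Yᶜ) : Z ∈ coarseBoundary Y :=
  ⟨Z, ⟨r, hr, h1⟩, Z, ⟨s, hs, h2⟩, Set.inter_self Z⟩

theorem cthickening_one_subset_neighborhood {r : ℝ} {Y Z : Set X} (h : Z ⊆ neighborhood r Y) :
    Metric.cthickening 1 Z ⊆ neighborhood (r + 2) Y := fun x hx => by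
  obtain ⟨z, hz, hxz⟩ := cthickening_subset_neighborhood zero_le_one one_lt_two Z hx
  obtain ⟨y, hy, hzy⟩ := h hz
  exact ⟨y, hy, (dist_triangle x z y).trans (by linarith)⟩

theorem cthickening_one_mem_coarseBoundary {Y Z : Set X} (hZ : Z ∈ coarseBoundary Y) :
    Metric.cthickening 1 Z ∈ coarseBoundary Y := by
  obtain ⟨A, ⟨r, hr, hA⟩, B, ⟨s, hs, hB⟩, rfl⟩ := hZ
  exact mem_coarseBoundary (r := r + 2) (s := s + 2) (by linarith) (by linarith)
    (cthickening_one_subset_neighborhood (Set.inter_subset_left.trans hA))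
    (cthickening_one_subset_neighborhood (Set.inter_subset_right.trans hB))

theorem cthickening_inter_compl_mem_coarseBoundary {r : ℝ} (hr : 0 ≤ r) (W : Set X) :
    Metric.cthickening r W ∩ Wᶜ ∈ coarseBoundary W :=
  mem_coarseBoundary (r := r + 1) (s := 1) (by linarith) one_pos
    (Set.inter_subset_left.trans (cthickening_subset_neighborhood hr (by linarith) W))
    fun x hx => ⟨x, hx.2, by simp⟩

end Thickening

/-! ### Commutators with operators in the localized Roe algebra -/

section Commutator

variable {H : Type u} [NormedAddCommGroup H] [InnerProductSpace ℂ H]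

theorem continuous_lie_left (P : H →L[ℂ] H) : Continuous fun T : H →L[ℂ] H => ⁅P, T⁆ := by
  simp only [Ring.lie_def]
  fun_prop

variable [CompleteSpace H] {X : Type v} [MetricSpace X]

theorem chi_mul_eq_zero {ρ : C₀(X, ℂ) →⋆ₙₐ[ℂ] (H →L[ℂ] H)} {U : Set X} (hU : IsOpen U) {T : H →L[ℂ] H}
    (h : ∀ f : C₀(X, ℂ), (∀ x ∉ U, f x = 0) → ρ f * T = 0) : chi ρ U * T = 0 := by
  ext ξ
  refine (Submodule.starProjection_apply_eq_zero_iff _).2 ?_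
  rw [spectralSubspace_of_isOpen ρ hU, essentialSubspace, Submodule.orthogonal_closure]
  rw [Submodule.mem_orthogonal]
  intro η hη
  induction hη using Submodule.span_induction with
  | mem η hη =>
    obtain ⟨f, hf, ζ, rfl⟩ := hη
    rw [← ContinuousLinearMap.adjoint_inner_right, ← ContinuousLinearMap.star_eq_adjoint,
      ← map_star]
    have h0 := congrArg (fun S : H →L[ℂ] H => S ξ)
      (h (star f) fun x hx => by simp [hf x hx])
    exact (congrArg (fun z => ⟪ζ, z⟫_ℂ) h0).trans (inner_zero_right ζ)
  | zero => simp
  | add x y _ _ hx hy => rw [inner_add_left, hx, hy, add_zero]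
  | smul a x _ hx => rw [inner_smul_left, hx, mul_zero]

variable [MeasurableSpace X]
variable (ρ : C₀(X, ℂ) →⋆ₙₐ[ℂ] (H →L[ℂ] H))

/-- `S` maps vectors supported in `V` to vectors supported in the closed `r`-neighbourhood of `V`,
and so does `S*`. -/
def IsControlled (r : ℝ) (S : H →L[ℂ] H) : Prop :=
  ∀ V : Set X, MeasurableSet V →
    chi ρ (Metric.cthickening r V) * (S * chi ρ V) = S * chi ρ V ∧
      (chi ρ V * S) * chi ρ (Metric.cthickening r V) = chi ρ V * S

variable {ρ}

theorem IsControlled.mono {r s : ℝ} (hrs : r ≤ s) {S : H →L[ℂ] H} (h : IsControlled ρ r S) :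
    IsControlled ρ s S := fun V hV => by
  have hsub : Metric.cthickening r V ⊆ Metric.cthickening s V := Metric.cthickening_mono hrs V
  obtain ⟨h1, h2⟩ := h V hV
  constructor
  · rw [← h1, ← mul_assoc, chi_mul_of_subset ρ hsub]
  · rw [← h2, mul_assoc, chi_mul_of_subset_right ρ hsub]

theorem IsControlled.add {r : ℝ} {S T : H →L[ℂ] H} (hS : IsControlled ρ r S)
    (hT : IsControlled ρ r T) : IsControlled ρ r (S + T) := fun V hV => by
  constructor
  · rw [add_mul, mul_add, (hS V hV).1, (hT V hV).1]
  · rw [mul_add, add_mul, (hS V hV).2, (hT V hV).2]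

theorem IsControlled.smul {r : ℝ} {S : H →L[ℂ] H} (a : ℂ) (hS : IsControlled ρ r S) :
    IsControlled ρ r (a • S) := fun V hV => by
  constructor
  · rw [smul_mul_assoc, mul_smul_comm, (hS V hV).1]
  · rw [mul_smul_comm, smul_mul_assoc, (hS V hV).2]

theorem IsControlled.star {r : ℝ} {S : H →L[ℂ] H} (hS : IsControlled ρ r S) :
    IsControlled ρ r (star S) := fun V hV => by
  constructor
  · have h := congrArg Star.star (hS V hV).2
    simpa only [star_mul, star_chi, mul_assoc] using h
  · have h := congrArg Star.star (hS V hV).1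
    simpa only [star_mul, star_chi, mul_assoc] using h

variable [BorelSpace X]

theorem IsControlled.mul {r s : ℝ} (hr : 0 ≤ r) (hs : 0 ≤ s) {S T : H →L[ℂ] H}
    (hS : IsControlled ρ r S) (hT : IsControlled ρ s T) : IsControlled ρ (r + s) (S * T) := by
  intro V hV
  constructor
  · have hsub := Metric.cthickening_cthickening_subset hr hs V
    have h1 := (hT V hV).1
    have h2 := (hS (Metric.cthickening s V) Metric.isClosed_cthickening.measurableSet).1
    have h3 : S * T * chi ρ V =
        chi ρ (Metric.cthickening r (Metric.cthickening s V)) *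
          (S * chi ρ (Metric.cthickening s V) * (T * chi ρ V)) := by
      rw [← mul_assoc, h2, mul_assoc S (chi ρ _), h1, mul_assoc]
    rw [h3, ← mul_assoc, chi_mul_of_subset ρ hsub]
  · have hsub := Metric.cthickening_cthickening_subset hs hr V
    rw [add_comm s r] at hsub
    have h1 := (hS V hV).2
    have h2 := (hT (Metric.cthickening r V) Metric.isClosed_cthickening.measurableSet).2
    have h3 : chi ρ V * (S * T) =
        (chi ρ V * S) * (chi ρ (Metric.cthickening r V) * T) *
          chi ρ (Metric.cthickening s (Metric.cthickening r V)) := by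
      rw [mul_assoc (chi ρ V * S), h2, ← mul_assoc, ← mul_assoc, h1]
    rw [h3, mul_assoc, chi_mul_of_subset_right ρ hsub]

theorem HasFinitePropagation.exists_isControlled [ProperSpace X] (hρ : IsNondegenerate ρ)
    {S : H →L[ℂ] H} (hS : HasFinitePropagation ρ S) : ∃ r : ℝ, 0 ≤ r ∧ IsControlled ρ r S := by
  obtain ⟨r, hr, h⟩ := hS
  refine ⟨r + 1, by linarith, fun V hV => ?_⟩
  have hm : MeasurableSet (Metric.cthickening (r + 1) V) :=
    Metric.isClosed_cthickening.measurableSet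
  have hdist : ∀ x ∈ (Metric.cthickening (r + 1) V)ᶜ, ∀ y ∈ V,
      ENNReal.ofReal (r + 1) ≤ edist x y := fun x hx y hy => by
    by_contra hlt
    refine hx (Metric.mem_cthickening_iff.2 ?_)
    exact (Metric.infEDist_le_edist_of_mem hy).trans (not_le.1 hlt).le
  have hlt : ENNReal.ofReal r < ENNReal.ofReal (r + 1) :=
    (ENNReal.ofReal_lt_ofReal_iff (by linarith)).2 (by linarith)
  constructor
  · have h1 := h _ V hm.compl hV (hlt.trans_le (le_iInf₂ fun x hx => le_iInf₂ fun y hy =>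
      hdist x hx y hy))
    rw [chi_compl ρ hρ hm, sub_mul, sub_mul, one_mul, sub_eq_zero] at h1
    rw [← mul_assoc, ← h1]
  · have h1 := h V _ hV hm.compl (hlt.trans_le (le_iInf₂ fun y hy => le_iInf₂ fun x hx => by
      rw [edist_comm]; exact hdist x hx y hy))
    rw [chi_compl ρ hρ hm, mul_sub, mul_one, sub_eq_zero] at h1
    exact h1.symm

theorem isLocallyCompact_and_isControlled_of_mem_adjoin [ProperSpace X] (hρ : IsNondegenerate ρ)
    {S : H →L[ℂ] H} (hS : S ∈ NonUnitalStarAlgebra.adjoin ℂ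
      {T : H →L[ℂ] H | IsLocallyCompact ρ T ∧ HasFinitePropagation ρ T}) :
    IsLocallyCompact ρ S ∧ ∃ r : ℝ, 0 ≤ r ∧ IsControlled ρ r S := by
  induction hS using NonUnitalStarAlgebra.adjoin_induction with
  | mem T hT => exact ⟨hT.1, hT.2.exists_isControlled hρ⟩
  | add S T _ _ hS hT =>
    obtain ⟨cS, r, hr, hS⟩ := hS
    obtain ⟨cT, s, hs, hT⟩ := hT
    refine ⟨fun W hW hb => ⟨?_, ?_⟩, max r s, le_max_of_le_left hr,
      (hS.mono (le_max_left _ _)).add (hT.mono (le_max_right _ _))⟩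
    · rw [mul_add]; exact (cS W hW hb).1.add (cT W hW hb).1
    · rw [add_mul]; exact (cS W hW hb).2.add (cT W hW hb).2
  | zero =>
    refine ⟨fun W _ _ => ?_, 0, le_rfl, fun V _ => by simp⟩
    rw [mul_zero, zero_mul]
    exact ⟨isCompactOperator_zero, isCompactOperator_zero⟩
  | mul S T _ _ hS hT =>
    obtain ⟨cS, r, hr, hS⟩ := hS
    obtain ⟨cT, s, hs, hT⟩ := hT
    refine ⟨fun W hW hb => ⟨?_, ?_⟩, r + s, add_nonneg hr hs, hS.mul hr hs hT⟩
    · rw [← mul_assoc]; exact (cS W hW hb).1.comp_clm T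
    · rw [mul_assoc]; exact (cT W hW hb).2.clm_comp S
  | smul a S _ hS =>
    obtain ⟨cS, r, hr, hS⟩ := hS
    refine ⟨fun W hW hb => ⟨?_, ?_⟩, r, hr, hS.smul a⟩
    · rw [mul_smul_comm]; exact (cS W hW hb).1.smul a
    · rw [smul_mul_assoc]; exact (cS W hW hb).2.smul a
  | star S _ hS =>
    obtain ⟨cS, r, hr, hS⟩ := hS
    refine ⟨fun W hW hb => ⟨?_, ?_⟩, r, hr, hS.star⟩
    · have := isCompactOperator_star (cS W hW hb).2
      rwa [star_mul, star_chi] at this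
    · have := isCompactOperator_star (cS W hW hb).1
      rwa [star_mul, star_chi] at this

theorem IsSupportedIn.exists_chi_mul [ProperSpace X] (hρ : IsNondegenerate ρ) {Y : Set X}
    {T : H →L[ℂ] H} (hT : IsSupportedIn ρ (coarseBoundary Y) T) :
    ∃ D ∈ coarseBoundary Y, MeasurableSet D ∧ chi ρ D * T * chi ρ D = T := by
  obtain ⟨Z, hZ, h⟩ := hT
  refine ⟨Metric.cthickening 1 Z, cthickening_one_mem_coarseBoundary hZ,
    Metric.isClosed_cthickening.measurableSet, ?_⟩
  have hm : MeasurableSet (Metric.cthickening 1 Z) := Metric.isClosed_cthickening.measurableSet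
  have hU : IsOpen (Metric.cthickening 1 Z)ᶜ := Metric.isClosed_cthickening.isOpen_compl
  have hsupp : ∀ f : C₀(X, ℂ), (∀ x ∉ (Metric.cthickening 1 Z)ᶜ, f x = 0) →
      tsupport f ⊆ Zᶜ := fun f hf => by
    have h1 : tsupport f ⊆ (Metric.thickening 1 Z)ᶜ :=
      closure_minimal (fun x hx hxZ => hx (hf x fun hx' =>
        hx' (Metric.thickening_subset_cthickening 1 Z hxZ))) Metric.isOpen_thickening.isClosed_compl
    exact h1.trans (Set.compl_subset_compl.2 (Metric.self_subset_thickening one_pos Z))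
  have z1 : chi ρ (Metric.cthickening 1 Z)ᶜ * T = 0 :=
    chi_mul_eq_zero hU fun f hf => (h f (hsupp f hf)).1
  have z2 : chi ρ (Metric.cthickening 1 Z)ᶜ * star T = 0 :=
    chi_mul_eq_zero hU fun f hf => by
      have := congrArg Star.star (h (star f) (hsupp _ fun x hx => by simp [hf x hx])).2
      rwa [star_mul, ← map_star, star_star, star_zero] at this
  rw [chi_compl ρ hρ hm, sub_mul, one_mul, sub_eq_zero] at z1 z2
  have z3 := congrArg Star.star z2
  rw [star_mul, star_star, star_chi] at z3
  rw [← z1, ← z3]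

theorem isCompactOperator_lie_compression [ProperSpace X] (hρ : IsNondegenerate ρ) {Y W D : Set X}
    (hYW : AreTransversal Y W) (hW : MeasurableSet W) (hDY : D ∈ coarseBoundary Y)
    (hD : MeasurableSet D) {S : H →L[ℂ] H} (hS : IsLocallyCompact ρ S) {r : ℝ} (hr : 0 ≤ r)
    (hSr : IsControlled ρ r S) :
    IsCompactOperator (⁅chi ρ W, chi ρ D * S * chi ρ D⁆ : H →L[ℂ] H) := by
  set N := Metric.cthickening r W ∩ Wᶜ with hN
  have hcm : MeasurableSet (Metric.cthickening r W) := Metric.isClosed_cthickening.measurableSet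
  have hNm : MeasurableSet N := hcm.inter hW.compl
  have hb : Bornology.IsBounded (D ∩ N) :=
    hYW _ ⟨D, hDY, N, cthickening_inter_compl_mem_coarseBoundary hr W, rfl⟩
  have hcomm : chi ρ D * chi ρ W = chi ρ W * chi ρ D := by
    rw [← chi_inter ρ hρ hD hW, ← chi_inter ρ hρ hW hD, Set.inter_comm]
  obtain ⟨h1, h2⟩ := hSr W hW
  -- the two off-diagonal corners of `S`
  have c1 : (1 - chi ρ W) * S * chi ρ W = chi ρ N * S * chi ρ W := by
    rw [mul_assoc, ← h1, ← chi_compl ρ hρ hW, ← mul_assoc, ← chi_inter ρ hρ hW.compl hcm,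
      Set.inter_comm, mul_assoc]
  have c2 : chi ρ W * S * (1 - chi ρ W) = chi ρ W * S * chi ρ N := by
    rw [hN, chi_inter ρ hρ hcm hW.compl, ← mul_assoc, h2, chi_compl ρ hρ hW]
  have hND : chi ρ N * chi ρ D = chi ρ (D ∩ N) := by
    rw [← chi_inter ρ hρ hNm hD, Set.inter_comm]
  have hDN : chi ρ D * chi ρ N = chi ρ (D ∩ N) := (chi_inter ρ hρ hD hNm).symm
  have key : ⁅chi ρ W, chi ρ D * S * chi ρ D⁆ =
      chi ρ W * chi ρ D * (S * chi ρ (D ∩ N)) - chi ρ (D ∩ N) * S * (chi ρ W * chi ρ D) := by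
    have e1 : chi ρ W * chi ρ D * (S * chi ρ (D ∩ N)) =
        chi ρ D * (chi ρ W * S * (1 - chi ρ W)) * chi ρ D := by
      rw [c2, ← hND, ← hcomm]; simp only [mul_assoc]
    have e2 : chi ρ (D ∩ N) * S * (chi ρ W * chi ρ D) =
        chi ρ D * ((1 - chi ρ W) * S * chi ρ W) * chi ρ D := by
      rw [c1, ← hDN]; simp only [mul_assoc]
    have e3 : chi ρ W * (chi ρ D * S * chi ρ D) = chi ρ D * (chi ρ W * S) * chi ρ D := by
      simp only [← mul_assoc, hcomm]
    have e4 : chi ρ D * S * chi ρ D * chi ρ W = chi ρ D * (S * chi ρ W) * chi ρ D := by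
      simp only [mul_assoc, hcomm]
    rw [e1, e2, Ring.lie_def, e3, e4]
    noncomm_ring
  rw [key]
  exact ((hS _ (hD.inter hNm) hb).2.clm_comp (chi ρ W * chi ρ D)).sub
    ((hS _ (hD.inter hNm) hb).1.comp_clm (chi ρ W * chi ρ D))

/-- For transversal `Y` and `W`, the projection `χ_W` commutes modulo compact operators with the
Roe algebra localized at `∂Y`. -/
theorem isCompactOperator_lie_chi [ProperSpace X] (hρ : IsNondegenerate ρ) {Y W : Set X}
    (hYW : AreTransversal Y W) (hW : MeasurableSet W) {T : H →L[ℂ] H}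
    (hT : T ∈ localizedRoeAlgebra ρ (coarseBoundary Y)) :
    IsCompactOperator (⁅chi ρ W, T⁆ : H →L[ℂ] H) := by
  have hcl : IsClosed {T : H →L[ℂ] H | IsCompactOperator (⁅chi ρ W, T⁆ : H →L[ℂ] H)} :=
    isClosed_setOfPred_isCompactOperator.preimage (continuous_lie_left (chi ρ W))
  have hgen : ∀ T ∈ {T : H →L[ℂ] H | T ∈ roeAlgebra ρ ∧ IsSupportedIn ρ (coarseBoundary Y) T},
      IsCompactOperator (⁅chi ρ W, T⁆ : H →L[ℂ] H) := by
    rintro T ⟨hTroe, hTsupp⟩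
    obtain ⟨D, hDY, hD, hDT⟩ := hTsupp.exists_chi_mul hρ
    have hcl' : IsClosed {S : H →L[ℂ] H |
        IsCompactOperator (⁅chi ρ W, chi ρ D * S * chi ρ D⁆ : H →L[ℂ] H)} :=
      hcl.preimage (f := fun S : H →L[ℂ] H => chi ρ D * S * chi ρ D) (by fun_prop)
    have hmem : T ∈ {S : H →L[ℂ] H |
        IsCompactOperator (⁅chi ρ W, chi ρ D * S * chi ρ D⁆ : H →L[ℂ] H)} := by
      refine closure_minimal (fun S hS => ?_) hcl' hTroe
      obtain ⟨cS, r, hr, hSr⟩ := isLocallyCompact_and_isControlled_of_mem_adjoin hρ hS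
      exact isCompactOperator_lie_compression hρ hYW hW hDY hD cS hr hSr
    rwa [Set.mem_ofPred_eq, hDT] at hmem
  refine closure_minimal (fun S hS => ?_) hcl hT
  rw [Set.mem_ofPred_eq]
  induction hS using NonUnitalStarAlgebra.adjoin_induction with
  | mem S hS => exact hgen S hS
  | add S T _ _ hS hT =>
    have : ⁅chi ρ W, S + T⁆ = ⁅chi ρ W, S⁆ + ⁅chi ρ W, T⁆ := by
      simp only [Ring.lie_def]; noncomm_ring
    rw [this]
    exact hS.add hT
  | zero =>
    rw [Ring.lie_def, mul_zero, zero_mul, sub_zero]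
    exact isCompactOperator_zero
  | mul S T _ _ hS hT =>
    have : ⁅chi ρ W, S * T⁆ = ⁅chi ρ W, S⁆ * T + S * ⁅chi ρ W, T⁆ := by
      simp only [Ring.lie_def]; noncomm_ring
    rw [this]
    exact (hS.comp_clm T).add (hT.clm_comp S)
  | smul a S _ hS =>
    have : ⁅chi ρ W, a • S⁆ = a • ⁅chi ρ W, S⁆ := by
      simp only [Ring.lie_def, mul_smul_comm, smul_mul_assoc, smul_sub]
    rw [this]
    exact hS.smul a
  | star S _ hS =>
    have : ⁅chi ρ W, star S⁆ = -star ⁅chi ρ W, S⁆ := by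
      simp only [Ring.lie_def, star_sub, star_mul, star_chi, neg_sub]
    rw [this]
    exact (isCompactOperator_star hS).neg

end Commutator

/-! ### Compressions of unitaries -/

section Compression

variable {E : Type u} [NormedAddCommGroup E] [InnerProductSpace ℂ E]
variable {P U : E →L[ℂ] E}

theorem isCompactOperator_compression_mul_sub_one {V : E →L[ℂ] E} (hPP : P * P = P)
    (hUV : U * V = 1) (hK : IsCompactOperator (⁅P, V⁆ : E →L[ℂ] E)) :
    IsCompactOperator ((P * U * P + (1 - P)) * (P * V * P + (1 - P)) - 1 : E →L[ℂ] E) := by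
  have key : (P * U * P + (1 - P)) * (P * V * P + (1 - P)) - 1 = P * U * ⁅P, V⁆ * P := by
    have e1 : P * (1 - P) = 0 := by rw [mul_sub, mul_one, hPP, sub_self]
    have e2 : (1 - P) * P = 0 := by rw [sub_mul, one_mul, hPP, sub_self]
    have e3 : (1 - P) * (1 - P) = 1 - P := by rw [mul_sub, e2, mul_one, sub_zero]
    have l1 : (P * U * P + (1 - P)) * (P * V * P + (1 - P)) =
        P * U * (P * P) * V * P + P * U * (P * (1 - P)) + ((1 - P) * P) * V * P +
          (1 - P) * (1 - P) := by noncomm_ring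
    rw [l1, e1, e2, e3, hPP, Ring.lie_def, mul_sub, sub_mul,
      show P * U * (V * P) * P = P * (U * V) * (P * P) by noncomm_ring, hUV, hPP, mul_one, hPP]
    noncomm_ring
  rw [key]
  exact (hK.clm_comp (P * U)).comp_clm P

theorem mem_ker_compression_iff (hPP : P * P = P) (x : E) :
    x ∈ LinearMap.ker ((P * U * P + (1 - P) : E →L[ℂ] E) : E →ₗ[ℂ] E) ↔
      P x = x ∧ P (U x) = 0 := by
  have hPx : ∀ y, P (P y) = P y := fun y => congrArg (fun T : E →L[ℂ] E => T y) hPP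
  have happ : (P * U * P + (1 - P)) x = P (U (P x)) + (x - P x) := rfl
  rw [LinearMap.mem_ker]
  change (P * U * P + (1 - P)) x = 0 ↔ _
  rw [happ]
  constructor
  · intro h
    have h1 : P (U (P x)) = 0 := by
      have := congrArg P h
      rwa [map_add, map_sub, hPx, hPx, sub_self, add_zero, map_zero] at this
    rw [h1, zero_add, sub_eq_zero] at h
    exact ⟨h.symm, by rwa [← h] at h1⟩
  · rintro ⟨h1, h2⟩
    rw [h1, h2, sub_self, add_zero]

variable [CompleteSpace E]

theorem isAnticommutingPair_of_projections {P Q : E →L[ℂ] E} (hP : IsSelfAdjoint P)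
    (hPP : P * P = P) (hQ : IsSelfAdjoint Q) (hQQ : Q * Q = Q) :
    IsAnticommutingPair (Q - P) (1 - P - Q) where
  left_selfAdjoint := hQ.sub hP
  right_selfAdjoint := ((IsSelfAdjoint.one _).sub hP).sub hQ
  anticommute := by simp only [mul_sub, sub_mul, mul_one, one_mul, hPP, hQQ]; abel
  sq_add_sq := by simp only [mul_sub, sub_mul, mul_one, one_mul, hPP, hQQ]; abel

theorem sub_apply_eq_self_iff {P Q : E →L[ℂ] E} (hP : IsSelfAdjoint P)
    (hPP : P * P = P) (hQ : IsSelfAdjoint Q) (hQQ : Q * Q = Q) (x : E) :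
    (Q - P) x = x ↔ Q x = x ∧ P x = 0 := by
  refine ⟨fun h => ?_, fun ⟨h1, h2⟩ => by rw [sub_apply, h1, h2, sub_zero]⟩
  have hn := (isAnticommutingPair_of_projections hP hPP hQ hQQ).norm_sq_add_norm_sq x
  rw [h, add_eq_left, sq_eq_zero_iff, norm_eq_zero, sub_apply, sub_apply, one_apply_eq_self] at hn
  rw [sub_apply] at h
  have hPx : (2 : ℂ) • P x = 0 := by
    rw [two_smul]
    calc P x + P x = (Q x - (Q x - P x)) + (x - (x - P x - Q x) - Q x) := by abel
      _ = 0 := by rw [h, hn]; abel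
  have hPx' : P x = 0 := (smul_eq_zero.1 hPx).resolve_left two_ne_zero
  exact ⟨by rwa [hPx', sub_zero] at h, hPx'⟩

theorem star_compression (hP : IsSelfAdjoint P) :
    star (P * U * P + (1 - P)) = P * star U * P + (1 - P) := by
  simp only [star_add, star_sub, star_mul, star_one, hP.star_eq, mul_assoc]

theorem isCompactOperator_lie_star (hP : IsSelfAdjoint P)
    (hK : IsCompactOperator (⁅P, U⁆ : E →L[ℂ] E)) :
    IsCompactOperator (⁅P, star U⁆ : E →L[ℂ] E) := by
  have : ⁅P, star U⁆ = -star ⁅P, U⁆ := by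
    simp only [Ring.lie_def, star_sub, star_mul, hP.star_eq, neg_sub]
  rw [this]
  exact (isCompactOperator_star hK).neg

theorem isFredholm_compression (hP : IsSelfAdjoint P) (hPP : P * P = P)
    (hU : U * star U = 1) (hU' : star U * U = 1)
    (hK : IsCompactOperator (⁅P, U⁆ : E →L[ℂ] E)) : IsFredholm (P * U * P + (1 - P)) :=
  isFredholm_of_parametrix (S := P * star U * P + (1 - P))
    (isCompactOperator_compression_mul_sub_one hPP hU' hK)
    (isCompactOperator_compression_mul_sub_one hPP hU (isCompactOperator_lie_star hP hK))

/-- The index of the compression of a unitary `U` is the trace of `U [P, U*]`. -/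
theorem hasTrace_fredholmIndex_compression (hP : IsSelfAdjoint P) (hPP : P * P = P)
    (hU : U * star U = 1) (hU' : star U * U = 1)
    (hK : IsCompactOperator (⁅P, U⁆ : E →L[ℂ] E))
    (hT : IsTraceClass (U * ⁅P, star U⁆)) :
    HasTrace (U * ⁅P, star U⁆) (fredholmIndex (P * U * P + (1 - P)) : ℂ) := by
  set F := P * U * P + (1 - P) with hF
  have hstar : star F = P * star U * P + (1 - P) := star_compression hP
  have hK' := isCompactOperator_lie_star hP hK
  have c1 : IsCompactOperator (star F * F - 1 : E →L[ℂ] E) := by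
    rw [hstar]; exact isCompactOperator_compression_mul_sub_one hPP hU' hK
  have c2 : IsCompactOperator (F * star F - 1 : E →L[ℂ] E) := by
    rw [hstar]; exact isCompactOperator_compression_mul_sub_one hPP hU hK'
  have f1 : FiniteDimensional ℂ (LinearMap.ker (F : E →ₗ[ℂ] E)) :=
    (isFredholm_of_parametrix c1 c2).1
  have f2 : FiniteDimensional ℂ (LinearMap.ker (star F : E →L[ℂ] E).toLinearMap) :=
    (isFredholm_of_parametrix c2 c1).1
  set Q := U * P * star U with hQdef
  have hQ : IsSelfAdjoint Q := by
    rw [IsSelfAdjoint, hQdef]; simp only [star_mul, star_star, hP.star_eq, mul_assoc]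
  have hQQ : Q * Q = Q := by
    rw [hQdef, show U * P * star U * (U * P * star U) = U * P * (star U * U) * P * star U by
      noncomm_ring, hU', mul_one, mul_assoc U P P, hPP]
  have hA : U * ⁅P, star U⁆ = Q - P := by
    rw [Ring.lie_def, mul_sub, ← mul_assoc, ← mul_assoc, hU, one_mul]
  have hUU : ∀ x, U (star U x) = x := fun x => congrArg (fun T : E →L[ℂ] E => T x) hU
  have hUU' : ∀ x, star U (U x) = x := fun x => congrArg (fun T : E →L[ℂ] E => T x) hU'
  have hQx : ∀ x, Q x = U (P (star U x)) := fun x => rfl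
  have hUinj : Function.Injective (U : E →ₗ[ℂ] E) :=
    Function.LeftInverse.injective (g := (star U : E →L[ℂ] E)) hUU'
  have m1 : ∀ x, x ∈ (LinearMap.ker (F : E →ₗ[ℂ] E)).map (U : E →ₗ[ℂ] E) ↔ (Q - P) x = x := by
    intro x
    rw [sub_apply_eq_self_iff hP hPP hQ hQQ, hQx]
    constructor
    · rintro ⟨y, hy, rfl⟩
      obtain ⟨h1, h2⟩ := (mem_ker_compression_iff hPP y).1 hy
      change U (P (star U (U y))) = U y ∧ P (U y) = 0
      exact ⟨by rw [hUU', h1], h2⟩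
    · rintro ⟨h1, h2⟩
      refine ⟨star U x, (mem_ker_compression_iff hPP _).2 ⟨?_, ?_⟩, hUU x⟩
      · have := congrArg (star U : E →L[ℂ] E) h1
        rwa [hUU'] at this
      · rw [hUU, h2]
  have m2 : ∀ x, x ∈ LinearMap.ker (star F : E →L[ℂ] E).toLinearMap ↔ (Q - P) x = -x := by
    intro x
    have hneg : (Q - P) x = -x ↔ (P - Q) x = x := by
      rw [sub_apply, sub_apply, ← neg_sub (P x), neg_inj]
    rw [hneg, sub_apply_eq_self_iff hQ hQQ hP hPP, hstar, mem_ker_compression_iff hPP, hQx]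
    refine and_congr_right fun _ => ⟨fun h => by rw [h, map_zero], fun h => ?_⟩
    exact hUinj (by rw [map_zero]; exact h)
  have f3 : FiniteDimensional ℂ ((LinearMap.ker (F : E →ₗ[ℂ] E)).map (U : E →ₗ[ℂ] E)) :=
    inferInstance
  rw [hA] at hT ⊢
  have h := (isAnticommutingPair_of_projections hP hPP hQ hQQ).hasTrace hT m1 m2
  rwa [(Submodule.equivMapOfInjective _ hUinj _).symm.finrank_eq,
    ← finrank_coker_eq_finrank_ker_star c1 c2] at h

end Compression

/-! ### Matrices of operators -/

section BlockOp

variable {E : Type u} [NormedAddCommGroup E] [InnerProductSpace ℂ E] {n : ℕ}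

theorem blockOp_apply (M : Matrix (Fin n) (Fin n) (E →L[ℂ] E)) (x : PiLp 2 fun _ : Fin n => E)
    (i : Fin n) : blockOp M x i = ∑ j, M i j (x j) := by
  simp [blockOp]

theorem blockOp_one : blockOp (1 : Matrix (Fin n) (Fin n) (E →L[ℂ] E)) = 1 := by
  ext x i
  rw [blockOp_apply, Finset.sum_eq_single i]
  · simp
  · intro j _ hj; simp [Matrix.one_apply_ne hj.symm]
  · simp

theorem blockOp_sub (M N : Matrix (Fin n) (Fin n) (E →L[ℂ] E)) :
    blockOp (M - N) = blockOp M - blockOp N := by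
  ext x i
  rw [sub_apply, PiLp.sub_apply, blockOp_apply, blockOp_apply, blockOp_apply,
    ← Finset.sum_sub_distrib]
  rfl

theorem blockOp_mul (M N : Matrix (Fin n) (Fin n) (E →L[ℂ] E)) :
    blockOp (M * N) = blockOp M * blockOp N := by
  ext x i
  rw [mul_apply_eq_comp, blockOp_apply, blockOp_apply]
  simp only [blockOp_apply, Matrix.mul_apply, map_sum, sum_apply, mul_apply_eq_comp]
  exact Finset.sum_comm

theorem blockOp_star [CompleteSpace E] (M : Matrix (Fin n) (Fin n) (E →L[ℂ] E)) :
    blockOp (star M) = star (blockOp M) := by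
  rw [ContinuousLinearMap.star_eq_adjoint, ContinuousLinearMap.eq_adjoint_iff]
  intro x y
  simp only [PiLp.inner_apply, blockOp_apply, sum_inner, inner_sum, Matrix.star_apply,
    ContinuousLinearMap.star_eq_adjoint, ContinuousLinearMap.adjoint_inner_left]
  exact Finset.sum_comm

/-- The inclusion of a summand of `E^n`. -/
def blockInclusion (i : Fin n) : E →L[ℂ] PiLp 2 fun _ : Fin n => E :=
  ((PiLp.continuousLinearEquiv 2 ℂ fun _ : Fin n => E).symm :
      (Fin n → E) →L[ℂ] PiLp 2 fun _ : Fin n => E) ∘L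
    ContinuousLinearMap.single ℂ (fun _ : Fin n => E) i

theorem blockOp_eq_sum (M : Matrix (Fin n) (Fin n) (E →L[ℂ] E)) :
    blockOp M = ∑ i, ∑ j, blockInclusion i ∘L M i j ∘L PiLp.proj 2 (fun _ : Fin n => E) j := by
  ext x i
  rw [blockOp_apply]
  simp only [sum_apply, blockInclusion, ContinuousLinearMap.comp_apply]
  simp [Pi.single_apply, Finset.sum_apply]

theorem isCompactOperator_blockOp {M : Matrix (Fin n) (Fin n) (E →L[ℂ] E)}
    (hM : ∀ i j, IsCompactOperator (M i j)) : IsCompactOperator (blockOp M) := by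
  have hsum : ∀ (s : Finset (Fin n)) (T : Fin n → (PiLp 2 fun _ : Fin n => E) →L[ℂ]
      PiLp 2 fun _ : Fin n => E), (∀ i, IsCompactOperator (T i)) →
        IsCompactOperator (∑ i ∈ s, T i : (PiLp 2 fun _ : Fin n => E) →L[ℂ]
          PiLp 2 fun _ : Fin n => E) := fun s T hT => by
    induction s using Finset.induction_on with
    | empty => rw [Finset.sum_empty]; exact isCompactOperator_zero
    | insert a s ha ih => rw [Finset.sum_insert ha]; exact (hT a).add ih
  rw [blockOp_eq_sum]
  exact hsum _ _ fun i => hsum _ _ fun j => ((hM i j).comp_clm _).clm_comp (blockInclusion i)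

theorem continuous_blockOp :
    Continuous (blockOp : Matrix (Fin n) (Fin n) (E →L[ℂ] E) → _) := by
  have : (blockOp : Matrix (Fin n) (Fin n) (E →L[ℂ] E) → _) = fun M =>
      ∑ i, ∑ j, blockInclusion i ∘L M i j ∘L PiLp.proj 2 (fun _ : Fin n => E) j :=
    funext blockOp_eq_sum
  rw [this]
  have : ContinuousAdd ((PiLp 2 fun _ : Fin n => E) →L[ℂ] PiLp 2 fun _ : Fin n => E) :=
    IsTopologicalAddGroup.toContinuousAdd
  refine continuous_finsetSum _ fun i _ => continuous_finsetSum _ fun j _ => ?_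
  exact continuous_const.clm_comp ((continuous_id.matrix_elem i j).clm_comp continuous_const)

end BlockOp

/-! ### Stabilization -/

section Stabilization

variable {H : Type u} [NormedAddCommGroup H] [InnerProductSpace ℂ H] {n m : ℕ}

/-- The inclusion of `H^n` in `H^(n+m)`. -/
def extendByZero (n m : ℕ) :
    (PiLp 2 fun _ : Fin n => H) →ₗ[ℂ] PiLp 2 fun _ : Fin (n + m) => H where
  toFun x := WithLp.toLp 2 (Fin.addCases (fun i => x i) fun _ => 0)
  map_add' x y := by
    ext k
    induction k using Fin.addCases <;> simp
  map_smul' a x := by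
    ext k
    induction k using Fin.addCases <;> simp

theorem extendByZero_castAdd (x : PiLp 2 fun _ : Fin n => H) (i : Fin n) :
    extendByZero n m x (Fin.castAdd m i) = x i := by
  simp [extendByZero]

theorem extendByZero_natAdd (x : PiLp 2 fun _ : Fin n => H) (i : Fin m) :
    extendByZero n m x (Fin.natAdd n i) = 0 := by
  simp [extendByZero]

theorem blockOp_stabilize_castAdd (M : Matrix (Fin n) (Fin n) (H →L[ℂ] H))
    (x : PiLp 2 fun _ : Fin (n + m) => H) (i : Fin n) :
    blockOp (stabilize (n + m) M) x (Fin.castAdd m i) = ∑ j, M i j (x (Fin.castAdd m j)) := by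
  rw [blockOp_apply, Fin.sum_univ_add]
  have h1 : ∀ j : Fin n, stabilize (n + m) M (Fin.castAdd m i) (Fin.castAdd m j) = M i j := by
    intro j; simp [stabilize]
  have h2 : ∀ j : Fin m, stabilize (n + m) M (Fin.castAdd m i) (Fin.natAdd n j) = 0 := by
    intro j
    have : Fin.castAdd m i ≠ Fin.natAdd n j := fun h => by
      have := congrArg Fin.val h
      simp only [Fin.val_castAdd, Fin.val_natAdd] at this
      omega
    simp [stabilize, this]
  simp [h1, h2]

theorem blockOp_stabilize_natAdd (M : Matrix (Fin n) (Fin n) (H →L[ℂ] H))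
    (x : PiLp 2 fun _ : Fin (n + m) => H) (i : Fin m) :
    blockOp (stabilize (n + m) M) x (Fin.natAdd n i) = x (Fin.natAdd n i) := by
  rw [blockOp_apply, Finset.sum_eq_single (Fin.natAdd n i)]
  · simp [stabilize]
  · intro j _ hj
    simp [stabilize, hj.symm]
  · simp

end Stabilization

/-! ### The index map -/

section IndexMap

variable {H : Type u} [NormedAddCommGroup H] [InnerProductSpace ℂ H] [CompleteSpace H]
variable {A : NonUnitalStarSubalgebra ℂ (H →L[ℂ] H)} {n : ℕ}

theorem unitaryOp_mul_star (u : UnitaryOver A n) : unitaryOp u * star (unitaryOp u) = 1 := by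
  have h : u.1 * star u.1 = 1 := Unitary.mul_star_self_of_mem u.2
  have hs : star (u.1.map (NonUnitalStarSubalgebra.unitization A)) =
      (star u.1).map (NonUnitalStarSubalgebra.unitization A) := by
    ext1 i j
    simp [Matrix.star_apply, map_star]
  rw [unitaryOp, ← blockOp_star, ← blockOp_mul, hs, ← Matrix.map_mul, h,
    Matrix.map_one _ (map_zero _) (map_one _), blockOp_one]

theorem star_unitaryOp_mul (u : UnitaryOver A n) : star (unitaryOp u) * unitaryOp u = 1 := by
  have h : star u.1 * u.1 = 1 := Unitary.star_mul_self_of_mem u.2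
  have hs : star (u.1.map (NonUnitalStarSubalgebra.unitization A)) =
      (star u.1).map (NonUnitalStarSubalgebra.unitization A) := by
    ext1 i j
    simp [Matrix.star_apply, map_star]
  rw [unitaryOp, ← blockOp_star, ← blockOp_mul, hs, ← Matrix.map_mul, h,
    Matrix.map_one _ (map_zero _) (map_one _), blockOp_one]

theorem continuous_unitization : Continuous (NonUnitalStarSubalgebra.unitization A) := by
  have : (NonUnitalStarSubalgebra.unitization A : Unitization ℂ A → H →L[ℂ] H) =
      fun x => algebraMap ℂ (H →L[ℂ] H) x.fst + (x.snd : H →L[ℂ] H) :=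
    funext fun x => NonUnitalStarSubalgebra.unitization_apply A x
  rw [this]
  exact ((continuous_algebraMap ℂ _).comp Unitization.continuous_fst).add
    (continuous_subtype_val.comp Unitization.continuous_snd)

variable {X : Type v} [MetricSpace X] (ρ : C₀(X, ℂ) →⋆ₙₐ[ℂ] (H →L[ℂ] H))

theorem chiN_apply (W : Set X) (x : PiLp 2 fun _ : Fin n => H) (i : Fin n) :
    chiN ρ n W x i = chi ρ W (x i) := by
  rw [chiN, blockOp_apply, Finset.sum_eq_single i]
  · simp
  · intro j _ hj; simp [Matrix.diagonal_apply_ne _ hj.symm]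
  · simp

theorem isSelfAdjoint_chiN (W : Set X) : IsSelfAdjoint (chiN ρ n W) := by
  rw [IsSelfAdjoint, chiN, ← blockOp_star, Matrix.star_eq_conjTranspose,
    Matrix.diagonal_conjTranspose]
  congr 2
  funext i
  exact star_chi ρ W

theorem chiN_mul_self (W : Set X) : chiN ρ n W * chiN ρ n W = chiN ρ n W := by
  rw [chiN, ← blockOp_mul, Matrix.diagonal_mul_diagonal]
  simp only [chi_mul_self]

theorem isCompactOperator_lie_chiN {W : Set X}
    (hA : ∀ a ∈ A, IsCompactOperator (⁅chi ρ W, a⁆ : H →L[ℂ] H)) (u : UnitaryOver A n) :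
    IsCompactOperator (⁅chiN ρ n W, unitaryOp u⁆ : _ →L[ℂ] _) := by
  rw [Ring.lie_def, chiN, unitaryOp, ← blockOp_mul, ← blockOp_mul, ← blockOp_sub]
  refine isCompactOperator_blockOp fun i j => ?_
  rw [Matrix.sub_apply, Matrix.diagonal_mul, Matrix.mul_diagonal, Matrix.map_apply,
    NonUnitalStarSubalgebra.unitization_apply]
  have h := hA _ (u.1 i j).snd.2
  rw [Ring.lie_def] at h
  rwa [mul_add, add_mul, ← Algebra.commutes (u.1 i j).fst (chi ρ W), add_sub_add_left_eq_sub]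

theorem map_stabilize (N : ℕ) (u : Matrix (Fin n) (Fin n) (Unitization ℂ A)) :
    (stabilize N u).map (NonUnitalStarSubalgebra.unitization A) =
      stabilize N (u.map (NonUnitalStarSubalgebra.unitization A)) := by
  ext1 i j
  simp only [stabilize, Matrix.map_apply, Matrix.of_apply]
  split_ifs <;> simp

theorem fredholmIndex_stabilize [MeasurableSpace X] [BorelSpace X] [ProperSpace X]
    (hρ : IsNondegenerate ρ) {W : Set X} (hW : MeasurableSet W) (u : UnitaryOver A n) {N : ℕ}
    (hN : n ≤ N) (u' : UnitaryOver A N) (hu' : u'.1 = stabilize N u.1) :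
    fredholmIndex (toeplitzOp ρ W u') = fredholmIndex (toeplitzOp ρ W u) := by
  obtain ⟨m, rfl⟩ := Nat.exists_eq_add_of_le hN
  have hop : unitaryOp u' =
      blockOp (stabilize (n + m) (u.1.map (NonUnitalStarSubalgebra.unitization A))) := by
    rw [unitaryOp, hu', map_stabilize]
  have t1 : ∀ (x : PiLp 2 fun _ : Fin (n + m) => H) (y : PiLp 2 fun _ : Fin n => H),
      (∀ i, x (Fin.castAdd m i) = y i) →
      ∀ i : Fin n, toeplitzOp ρ W u' x (Fin.castAdd m i) = toeplitzOp ρ W u y i := by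
    intro x y hxy i
    rw [toeplitzOp, toeplitzOp, hop, add_apply, add_apply, PiLp.add_apply, PiLp.add_apply,
      chiN_apply, chiN_apply, hxy i]
    congr 1
    rw [mul_apply_eq_comp, mul_apply_eq_comp, mul_apply_eq_comp, mul_apply_eq_comp, chiN_apply,
      chiN_apply, blockOp_stabilize_castAdd, unitaryOp, blockOp_apply]
    simp only [chiN_apply, hxy]
  have t2 : ∀ (x : PiLp 2 fun _ : Fin (n + m) => H) (i : Fin m),
      toeplitzOp ρ W u' x (Fin.natAdd n i) = x (Fin.natAdd n i) := by
    intro x i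
    rw [toeplitzOp, hop, add_apply, PiLp.add_apply, chiN_apply, mul_apply_eq_comp,
      mul_apply_eq_comp, chiN_apply, blockOp_stabilize_natAdd, chiN_apply, ← mul_apply_eq_comp,
      chi_mul_self, chi_compl ρ hρ hW, sub_apply, one_apply_eq_self, add_sub_cancel]
  let p : (PiLp 2 fun _ : Fin (n + m) => H) → PiLp 2 fun _ : Fin n => H :=
    fun x => WithLp.toLp 2 fun i => x (Fin.castAdd m i)
  have hp : ∀ x i, p x i = x (Fin.castAdd m i) := fun x i => rfl
  obtain ⟨⟨e1⟩, ⟨e2⟩⟩ := nonempty_ker_coker_equiv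
    (extendByZero (H := H) n m)
    (toeplitzOp ρ W u' : _ →ₗ[ℂ] _) (toeplitzOp ρ W u : _ →ₗ[ℂ] _)
    (fun x y hxy => by
      ext i
      rw [← extendByZero_castAdd (m := m) x, ← extendByZero_castAdd (m := m) y, hxy])
    (fun x => by
      ext k
      induction k using Fin.addCases with
      | left i =>
        rw [extendByZero_castAdd]
        exact t1 _ _ (extendByZero_castAdd x) i
      | right i =>
        rw [extendByZero_natAdd]
        exact (t2 _ i).trans (extendByZero_natAdd x i))
    (fun x ⟨y, hy⟩ => by
      refine ⟨p x, ?_⟩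
      ext k
      induction k using Fin.addCases with
      | left i => rw [extendByZero_castAdd]
      | right i =>
        rw [extendByZero_natAdd, ← t2 x i]
        have := congrArg (fun z : PiLp 2 fun _ : Fin (n + m) => H => z (Fin.natAdd n i)) hy
        exact (extendByZero_natAdd y i).symm.trans this)
    (fun x => by
      refine ⟨p x, x - extendByZero n m (p x), ?_⟩
      ext k
      rw [PiLp.add_apply]
      induction k using Fin.addCases with
      | left i =>
        have h0 : toeplitzOp ρ W u' (x - extendByZero n m (p x)) (Fin.castAdd m i) =
            toeplitzOp ρ W u 0 i := t1 _ 0 (fun j => by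
          rw [PiLp.sub_apply, extendByZero_castAdd, hp, sub_self]; rfl) i
        rw [map_zero] at h0
        rw [extendByZero_castAdd, hp]
        exact (add_zero _).symm.trans (congrArg _ h0.symm)
      | right i =>
        have h0 := t2 (x - extendByZero n m (p x)) i
        rw [PiLp.sub_apply, extendByZero_natAdd, sub_zero] at h0
        rw [extendByZero_natAdd, zero_add]
        exact h0.symm)
  unfold fredholmIndex
  rw [e1.finrank_eq, e2.finrank_eq]

variable [MeasurableSpace X] [BorelSpace X] [ProperSpace X]

theorem toeplitzOp_eq (hρ : IsNondegenerate ρ) {W : Set X} (hW : MeasurableSet W)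
    (u : UnitaryOver A n) :
    toeplitzOp ρ W u = chiN ρ n W * unitaryOp u * chiN ρ n W + (1 - chiN ρ n W) := by
  have : chiN ρ n Wᶜ = 1 - chiN ρ n W := by
    ext x i
    rw [sub_apply, PiLp.sub_apply, chiN_apply, chiN_apply, chi_compl ρ hρ hW]
    rfl
  rw [toeplitzOp, this]

theorem fredholmIndex_eq_of_stablyHomotopic (hρ : IsNondegenerate ρ) {W : Set X}
    (hW : MeasurableSet W) (hA : ∀ a ∈ A, IsCompactOperator (⁅chi ρ W, a⁆ : H →L[ℂ] H))
    {u v : Σ n : ℕ, UnitaryOver A n} (h : StablyHomotopic A u v) :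
    fredholmIndex (toeplitzOp ρ W u.2) = fredholmIndex (toeplitzOp ρ W v.2) := by
  obtain ⟨N, hu, hv, γ, hγ, h0, h1⟩ := h
  let w : unitInterval → UnitaryOver A N := fun t => ⟨γ t, hγ t⟩
  rw [← fredholmIndex_stabilize ρ hρ hW u.2 hu (w 0) h0,
    ← fredholmIndex_stabilize ρ hρ hW v.2 hv (w 1) h1]
  have hcont : Continuous fun t => unitaryOp (w t) :=
    continuous_blockOp.comp ((γ.continuous).matrix_map continuous_unitization)
  refine fredholmIndex_eq_of_path (F := fun t => toeplitzOp ρ W (w t))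
    (S := fun t => chiN ρ N W * star (unitaryOp (w t)) * chiN ρ N W + (1 - chiN ρ N W))
    ?_ (fun t => ?_) fun t => ?_
  · simp only [toeplitzOp_eq ρ hρ hW]
    exact ((continuous_const.mul hcont).mul continuous_const).add continuous_const
  · rw [toeplitzOp_eq ρ hρ hW]
    exact isCompactOperator_compression_mul_sub_one (chiN_mul_self ρ W)
      (star_unitaryOp_mul _) (isCompactOperator_lie_chiN ρ hA _)
  · rw [toeplitzOp_eq ρ hρ hW]
    exact isCompactOperator_compression_mul_sub_one (chiN_mul_self ρ W)
      (unitaryOp_mul_star _)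
      (isCompactOperator_lie_star (isSelfAdjoint_chiN ρ W) (isCompactOperator_lie_chiN ρ hA _))

theorem theta_mk (hρ : IsNondegenerate ρ) {W : Set X} (hW : MeasurableSet W)
    (hA : ∀ a ∈ A, IsCompactOperator (⁅chi ρ W, a⁆ : H →L[ℂ] H)) (u : UnitaryOver A n) :
    theta ρ W A (K1.mk u) = fredholmIndex (toeplitzOp ρ W u) := by
  let ind : K1 A → ℤ := Quot.lift (fun u => fredholmIndex (toeplitzOp ρ W u.2))
    fun _ _ h => fredholmIndex_eq_of_stablyHomotopic ρ hρ hW hA h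
  exact congrArg ind (Quot.out_eq (K1.mk u))

end IndexMap

end RoeKubo

end

theorem mainTheorem5 {X : Type v} [MetricSpace X] [ProperSpace X] [MeasurableSpace X] [BorelSpace X]
    {H : Type u} [NormedAddCommGroup H] [InnerProductSpace ℂ H] [CompleteSpace H]
    (ρ : C₀(X, ℂ) →⋆ₙₐ[ℂ] (H →L[ℂ] H))
    (hρ : RoeKubo.IsNondegenerate ρ) (hample : RoeKubo.IsAmple ρ)
    (Y W : Set X) (hY : MeasurableSet Y) (hW : MeasurableSet W)
    (hYW : RoeKubo.AreTransversal Y W)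
    (n : ℕ)
    (u : RoeKubo.UnitaryOver (RoeKubo.localizedRoeAlgebra ρ (RoeKubo.coarseBoundary Y)) n) :
    RoeKubo.IsFredholm (RoeKubo.toeplitzOp ρ W u) ∧
    RoeKubo.theta ρ W (RoeKubo.localizedRoeAlgebra ρ (RoeKubo.coarseBoundary Y)) (RoeKubo.K1.mk u) =
      RoeKubo.fredholmIndex (RoeKubo.toeplitzOp ρ W u) ∧
    (RoeKubo.IsTraceClass
        (RoeKubo.unitaryOp u * ⁅RoeKubo.chiN ρ n W, star (RoeKubo.unitaryOp u)⁆) →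
      RoeKubo.HasTrace
        (RoeKubo.unitaryOp u * ⁅RoeKubo.chiN ρ n W, star (RoeKubo.unitaryOp u)⁆)
        (RoeKubo.theta ρ W (RoeKubo.localizedRoeAlgebra ρ (RoeKubo.coarseBoundary Y))
          (RoeKubo.K1.mk u) : ℂ)) := by
  have hA : ∀ a ∈ RoeKubo.localizedRoeAlgebra ρ (RoeKubo.coarseBoundary Y),
      IsCompactOperator (⁅RoeKubo.chi ρ W, a⁆ : H →L[ℂ] H) :=
    fun a ha => RoeKubo.isCompactOperator_lie_chi hρ hYW hW ha
  have hP := RoeKubo.isSelfAdjoint_chiN (n := n) ρ W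
  have hPP := RoeKubo.chiN_mul_self (n := n) ρ W
  have hU := RoeKubo.unitaryOp_mul_star u
  have hU' := RoeKubo.star_unitaryOp_mul u
  have hK := RoeKubo.isCompactOperator_lie_chiN ρ hA u
  refine ⟨?_, RoeKubo.theta_mk ρ hρ hW hA u, fun hT => ?_⟩
  · rw [RoeKubo.toeplitzOp_eq ρ hρ hW]
    exact RoeKubo.isFredholm_compression hP hPP hU hU' hK
  · rw [RoeKubo.theta_mk ρ hρ hW hA u, RoeKubo.toeplitzOp_eq ρ hρ hW]
    exact RoeKubo.hasTrace_fredholmIndex_compression hP hPP hU hU' hK hT
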